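/- **Setting.** Let $X$ be a measurable space, $r\colon X\to X$ a measurable map of $X$ onto $X$ with $\# r^{-1}(x)<\infty$ for all $x$, and $\mu$ a probability measure on $X$ that is strongly $r$-invariant: $$\int_X f\,d\mu=\int_X\frac1{\#r^{-1}(x)}\sum_{r(y)=x}f(y)\,d\mu(x)$$ for all bounded measurable $f$ (equivalently, for all measurable $f\ge 0$). Let $m_0\in L^\infty(X,\mu)$ and put $$(R\xi)(x)=\frac1{\#r^{-1}(x)}\sum_{r(y)=x}|m_0(y)|^2\xi(y).$$ Let $h\in L^1(X,\mu)$ with $h\ge0$ and $Rh=h$, and assume that $m_0$ is non-singular, i.e. $m_0\neq0$ $\mu$-a.e. Relations between functions on $X$ are understood $\mu$-a.e. Let $X_\infty=\{(x_0,x_1,\dots)\mid r(x_{n+1})=x_n,\ n\ge0\}$ with coordinate maps $\theta_n(x_0,x_1,\dots)=x_n$ and the $\sigma$-algebra they generate, and let $\hat r(x_0,x_1,\dots)=(r(x_0),x_0,x_1,\dots)$. There is a unique measure $\hat\mu$ on $X_\infty$ such that $\int f\circ\theta_n\,d\hat\mu=\int_X R^n(fh)\,d\mu$ for all $n\ge0$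 and all measurable $f\ge0$ on $X$. The formula $Uv=(m_0\circ\theta_0)\,(v\circ\hat r)$ defines a unitary operator $U$ on $L^2(X_\infty,\hat\mu)$. For bounded measurable $g$ on $X$ put $\pi(g)v=(g\circ\theta_0)\,v$, and for bounded measurable $f$ on $X_\infty$ put $M_fv=fv$. A *cocycle* is a bounded measurable $f\colon X_\infty\to\mathbb C$ with $f=f\circ\hat r$ $\hat\mu$-a.e. Let $E_0(f)$ be the conditional expectation of $f$ on the $\sigma$-algebra generated by $\theta_0$, regarded as a function on $X$, i.e. $E_0(f)\circ\theta_0=\mathbb E_{\hat\mu}(f\mid\sigma(\theta_0))$ $\hat\mu$-a.e. (so $E_0(f)$ is determined up to sets of measure zero for $h\,d\mu$, and $E_0(f)h$ is determined $\mu$-a.e.). **Theorem.** 1. Every bounded operator $A$ on $L^2(X_\infty,\hat\mu)$ that commutes with $U$ and with all $\pi(g)$ is of the form $A=M_f$ for a cocycle $f$. Conversely, for every cocycle $f$ the operator $M_f$ commutes with $U$ and with all $\pi(g)$. 2. For every measurable $h_0\colon X\to\mathbb C$ with $Rh_0=h_0$ and $|h_0|^2\le c\,h^2$ for some constant $c\ge0$,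 there is a cocycle $f$, unique up to $\hat\mu$-a.e. equality, with $h_0=E_0(f)\,h$. Conversely, for every cocycle $f$ the function $h_0=E_0(f)\,h$ satisfies $Rh_0=h_0$ and $|h_0|^2\le c\,h^2$ for some $c\ge0$. 3. If $h_0$ and $f$ correspond to each other as in 2, then $$f=\lim_{n\to\infty}\frac{h_0}{h}\circ\theta_n$$ pointwise $\hat\mu$-a.e. and in $L^p(X_\infty,\hat\mu)$ for all $1\le p<\infty$. -/

import Mathlib

open MeasureTheory Filter Topology
open scoped ENNReal

noncomputable section

namespace Solenoid

/-- The Ruelle operator with weight `W`: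
`(R_W f)(x) = (1 / #r⁻¹(x)) * ∑_{r y = x} W y * f y`.
It is used for `𝕜 = ℂ` (functions) and for `𝕜 = ℝ≥0∞` (integrals of non-negative functions). -/
def ruelle {X 𝕜 : Type*} [CommSemiring 𝕜] [Inv 𝕜] (r : X → X) (W : X → 𝕜) (f : X → 𝕜) (x : X) :
    𝕜 :=
  ((Nat.card (r ⁻¹' {x}) : ℕ) : 𝕜)⁻¹ * ∑ᶠ y ∈ r ⁻¹' {x}, W y * f y

/-- The operator `R` attached to `m₀`, i.e. the Ruelle operator with weight `|m₀|²`,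
on complex functions. -/
def transfer {X : Type*} (r : X → X) (m₀ : X → ℂ) (f : X → ℂ) : X → ℂ :=
  ruelle r (fun y => ((‖m₀ y‖ ^ 2 : ℝ) : ℂ)) f

/-- The same operator `R` on functions with values in `[0, ∞]`. -/
def transferENN {X : Type*} (r : X → X) (m₀ : X → ℂ) (f : X → ℝ≥0∞) : X → ℝ≥0∞ :=
  ruelle r (fun y => ‖m₀ y‖ₑ ^ 2) f

/-- Strong `r`-invariance, `∫ f dμ = ∫ (1 / #r⁻¹(x)) ∑_{r y = x} f y dμ(x)`, stated for all
non-negative measurable `f`. For a probability measure this is the same as the identity for all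
bounded measurable `f`. -/
def StronglyInvariant {X : Type*} [MeasurableSpace X] (r : X → X) (μ : Measure X) : Prop :=
  ∀ f : X → ℝ≥0∞, Measurable f → ∫⁻ x, f x ∂μ = ∫⁻ x, ruelle r 1 f x ∂μ

/-- The projective limit `X_∞ = {(x₀, x₁, …) | r (x_{n+1}) = x_n}`. -/
def Sol {X : Type*} (r : X → X) : Type _ := {x : ℕ → X // ∀ n, r (x (n + 1)) = x n}

/-- The `σ`-algebra on `X_∞` generated by the coordinate projections. -/
instance {X : Type*} [MeasurableSpace X] (r : X → X) : MeasurableSpace (Sol r) :=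
  inferInstanceAs (MeasurableSpace {x : ℕ → X // ∀ n, r (x (n + 1)) = x n})

/-- The coordinate projection `θ_n`. -/
def θ {X : Type*} (r : X → X) (n : ℕ) (x : Sol r) : X := x.1 n

/-- The automorphism `r̂ (x₀, x₁, …) = (r x₀, x₀, x₁, …)`. -/
def rhat {X : Type*} (r : X → X) (x : Sol r) : Sol r :=
  ⟨fun n => Nat.casesOn n (r (x.1 0)) x.1, fun n => by
    cases n with
    | zero => rfl
    | succ k => exact x.2 k⟩

theorem measurable_θ {X : Type*} [MeasurableSpace X] (r : X → X) (n : ℕ) :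
    Measurable (θ r n) :=
  (measurable_pi_apply n).comp measurable_subtype_coe

/-- `ν ∘ θ_n⁻¹ = ω_n` for all `n`, where `ω_n(f) = ∫ Rⁿ(f h) dμ`. -/
def HasMarginals {X : Type*} [MeasurableSpace X] (r : X → X) (μ : Measure X) (m₀ : X → ℂ)
    (h : X → ℝ) (ν : Measure (Sol r)) : Prop :=
  ∀ n : ℕ, ∀ f : X → ℝ≥0∞, Measurable f →
    ∫⁻ x, f x ∂(ν.map (θ r n)) =
      ∫⁻ x, (transferENN r m₀)^[n] (fun y => f y * ENNReal.ofReal (h y)) x ∂μ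

/-- `(m₀, h)` is a Perron–Ruelle–Frobenius pair: `m₀ ∈ L^∞(X, μ)`, `h ∈ L¹(X, μ)`, `h ≥ 0` and
`R h = h`. -/
structure IsPRFPair {X : Type*} [MeasurableSpace X] (r : X → X) (μ : Measure X) (m₀ : X → ℂ)
    (h : X → ℝ) : Prop where
  memLp : MemLp m₀ ∞ μ
  integrable : Integrable h μ
  nonneg : 0 ≤ᵐ[μ] h
  harmonic : transfer r m₀ (fun x => (h x : ℂ)) =ᵐ[μ] fun x => (h x : ℂ)

/-- Bounded measurable complex functions. -/
def IsBddMeas {Ω : Type*} [MeasurableSpace Ω] (f : Ω → ℂ) : Prop :=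
  Measurable f ∧ ∃ C : ℝ, ∀ x, ‖f x‖ ≤ C

theorem IsBddMeas.memLp_top {Ω : Type*} [MeasurableSpace Ω] {f : Ω → ℂ} (hf : IsBddMeas f)
    (ν : Measure Ω) : MemLp f ∞ ν := by
  obtain ⟨C, hC⟩ := hf.2
  exact memLp_top_of_bound hf.1.aestronglyMeasurable C (Eventually.of_forall hC)

theorem IsBddMeas.comp {Ω Ω' : Type*} [MeasurableSpace Ω] [MeasurableSpace Ω'] {f : Ω → ℂ}
    (hf : IsBddMeas f) {φ : Ω' → Ω} (hφ : Measurable φ) : IsBddMeas (fun x => f (φ x)) :=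
  ⟨hf.1.comp hφ, hf.2.imp fun _ hC x => hC (φ x)⟩

/-- The multiplication operator `M_f` on `L²(ν)`, for a bounded measurable `f`. -/
def mulOp {Ω : Type*} [MeasurableSpace Ω] (ν : Measure Ω) {f : Ω → ℂ} (hf : IsBddMeas f) :
    Lp ℂ 2 ν →L[ℂ] Lp ℂ 2 ν :=
  (ContinuousLinearMap.mul ℂ ℂ).holderL ν ∞ 2 2 (hf.memLp_top ν).toLp

theorem mulOp_coeFn {Ω : Type*} [MeasurableSpace Ω] (ν : Measure Ω) {f : Ω → ℂ}
    (hf : IsBddMeas f) (v : Lp ℂ 2 ν) : mulOp ν hf v =ᵐ[ν] fun x => f x * v x := by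
  have h1 := (ContinuousLinearMap.mul ℂ ℂ).coeFn_holder (r := 2) (hf.memLp_top ν).toLp v
  filter_upwards [h1, (hf.memLp_top ν).coeFn_toLp] with x hx hx'
  rw [← hx']
  exact hx

/-- The representation `π(g)`, `g ∈ L^∞(X)`: multiplication by `g ∘ θ₀` on `L²(X_∞, ν)`. -/
def rep {X : Type*} [MeasurableSpace X] (r : X → X) (ν : Measure (Sol r)) {g : X → ℂ}
    (hg : IsBddMeas g) : Lp ℂ 2 ν →L[ℂ] Lp ℂ 2 ν :=
  mulOp ν (hg.comp (measurable_θ r 0))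

/-- Membership in the commutant of `U` and `π`. -/
def Commutes {X : Type*} [MeasurableSpace X] (r : X → X) (ν : Measure (Sol r))
    (U : Lp ℂ 2 ν ≃ₗᵢ[ℂ] Lp ℂ 2 ν) (A : Lp ℂ 2 ν →L[ℂ] Lp ℂ 2 ν) : Prop :=
  (∀ v, A (U v) = U (A v)) ∧
    ∀ (g : X → ℂ) (hg : IsBddMeas g) (v), A (rep r ν hg v) = rep r ν hg (A v)

/-- Cocycles: bounded measurable functions on `X_∞` with `f = f ∘ r̂` almost everywhere. -/
structure IsCocycle {X : Type*} [MeasurableSpace X] (r : X → X) (ν : Measure (Sol r))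
    (f : Sol r → ℂ) : Prop where
  bdd : IsBddMeas f
  invariant : f =ᵐ[ν] fun x => f (rhat r x)

theorem exists_condExp_factor {X : Type*} [MeasurableSpace X] (r : X → X) (ν : Measure (Sol r))
    (f : Sol r → ℂ) : ∃ e : X → ℂ, Measurable e ∧
      ν[f | MeasurableSpace.comap (θ r 0) inferInstance] = e ∘ θ r 0 :=
  Measurable.exists_eq_measurable_comp stronglyMeasurable_condExp.measurable

/-- The conditional expectation `E₀` onto the functions of the coordinate `x₀`, regarded as
functions on `X`: `E₀(f) ∘ θ₀ = E(f | σ(θ₀))`. -/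
def E₀ {X : Type*} [MeasurableSpace X] (r : X → X) (ν : Measure (Sol r)) (f : Sol r → ℂ) :
    X → ℂ :=
  (exists_condExp_factor r ν f).choose

theorem E₀_spec {X : Type*} [MeasurableSpace X] (r : X → X) (ν : Measure (Sol r))
    (f : Sol r → ℂ) : Measurable (E₀ r ν f) ∧
      ν[f | MeasurableSpace.comap (θ r 0) inferInstance] = E₀ r ν f ∘ θ r 0 :=
  (exists_condExp_factor r ν f).choose_spec

/-- Measurable harmonic functions `h₀` dominated by `h`: `R h₀ = h₀` and `|h₀|² ≤ c h²`. -/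
structure IsDominatedHarmonic {X : Type*} [MeasurableSpace X] (r : X → X) (μ : Measure X)
    (m₀ : X → ℂ) (h : X → ℝ) (h₀ : X → ℂ) : Prop where
  aestronglyMeasurable : AEStronglyMeasurable h₀ μ
  harmonic : transfer r m₀ h₀ =ᵐ[μ] h₀
  dominated : ∃ c : ℝ, 0 ≤ c ∧ ∀ᵐ x ∂μ, ‖h₀ x‖ ^ 2 ≤ c * h x ^ 2

end Solenoid

end

namespace Solenoid

/-! Strong invariance makes `R` adjoint to composition with `r`: `∫ (φ ∘ r) |m₀|² g dμ = ∫ φ · R g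
dμ` (`IsPRFPair.lintegral_comp_mul`). Iterating, the law required of `θ_n` has density `|m₀|² ⋯
(|m₀|² ∘ rⁿ⁻¹) h` with respect to `μ`, and `R h = h` makes these laws consistent under `r`. No
topology on `X` is needed to extend them to the projective limit: branching is finite, so decreasing
cylinders with empty intersection eventually miss each given fibre of `θ₀`
(`exists_cylinder_fibre_empty`), and domination by `h` turns this into continuity at `∅`.

Comparing the laws of consecutive coordinates gives the relation behind everything else
(`IsPathSystem.map_rhat`): `r̂` carries `|m₀ ∘ θ₀|² dμ̂` to `μ̂`. Hence `U` is isometric, and it is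
onto because `m₀ ≠ 0` allows division.

For the commutant, `U` intertwines multiplication by `g ∘ θ_{n+1}` with multiplication by `g ∘ θ_n`,
so an operator commuting with `U` and `π` commutes with multiplication by functions of every
coordinate. The coordinates generate the σ-algebra, so the operator is multiplication by its value
at `1` (`eq_mulOp_of_commute_setRing`), and commuting with `U` makes that function invariant.

For the correspondence, the density in `map_rhat` depends on `x₀` only, so conditioning on a
coordinate is compatible with the shift (`IsPathSystem.condExp_shift`). Consequently a cocycle `f`
satisfies `E(f | θ_n) = E₀(f) ∘ θ_n`. On the other side, `R(e h) = e h` is exactly the first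
martingale identity for the sequence `e ∘ θ_n` (`IsPathSystem.harmonic_iff`), and the shift
propagates it to all `n`. Cocycles and dominated harmonic functions are thus two descriptions of
bounded martingales of the form `e ∘ θ_n`: the tower property gives harmonicity, convergence of
bounded martingales produces the cocycle, and Lévy's upward theorem gives uniqueness and the limit
formula. -/

/-- A measurable surjection with finite fibres together with a strongly invariant measure. -/
structure IsFiniteCover {X : Type*} [MeasurableSpace X] (r : X → X) (μ : Measure X) : Prop where
  measurable : Measurable r
  surjective : Function.Surjective r
  finite_fibre : ∀ x, (r ⁻¹' {x}).Finite
  invariant : StronglyInvariant r μ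

/-! ### Fibrewise algebra of the Ruelle operator. -/

section Ruelle

variable {X 𝕜 : Type*} {r : X → X}

theorem ruelle_eq_sum [CommSemiring 𝕜] [Inv 𝕜] (hr : ∀ x, (r ⁻¹' {x}).Finite)
    (W f : X → 𝕜) (x : X) :
    ruelle r W f x = ((hr x).toFinset.card : 𝕜)⁻¹ * ∑ y ∈ (hr x).toFinset, W y * f y := by
  rw [ruelle, finsum_mem_eq_finite_toFinset_sum _ (hr x), Nat.card_coe_set_eq,
    Set.ncard_eq_toFinset_card _ (hr x)]

theorem ruelle_eq_ruelle_one [CommSemiring 𝕜] [Inv 𝕜] (W f : X → 𝕜) :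
    ruelle r W f = ruelle r 1 (fun y => W y * f y) := by
  funext x
  simp [ruelle]

theorem ruelle_congr [CommSemiring 𝕜] [Inv 𝕜] {W f g : X → 𝕜} {x : X}
    (h : ∀ y, r y = x → W y * f y = W y * g y) : ruelle r W f x = ruelle r W g x := by
  have := finsum_mem_congr (s := r ⁻¹' {x}) rfl (fun y hy => h y hy)
  rw [ruelle, ruelle, this]

theorem ruelle_comp_mul [CommSemiring 𝕜] [Inv 𝕜] (hr : ∀ x, (r ⁻¹' {x}).Finite)
    (W φ f : X → 𝕜) (x : X) :
    ruelle r W (fun y => φ (r y) * f y) x = φ x * ruelle r W f x := by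
  rw [ruelle_eq_sum hr, ruelle_eq_sum hr, mul_left_comm, Finset.mul_sum (a := φ x)]
  congr 1
  refine Finset.sum_congr rfl fun y hy => ?_
  have : r y = x := by simpa using hy
  rw [this, mul_left_comm]

theorem card_fibre_ne_zero (hr : ∀ x, (r ⁻¹' {x}).Finite) (hs : Function.Surjective r) (x : X) :
    (hr x).toFinset.card ≠ 0 := by
  obtain ⟨y, hy⟩ := hs x
  exact Finset.card_ne_zero_of_mem (a := y) (by simpa using hy)

theorem ruelle_add (hr : ∀ x, (r ⁻¹' {x}).Finite) [CommSemiring 𝕜] [Inv 𝕜]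
    (W f g : X → 𝕜) : ruelle r W (f + g) = ruelle r W f + ruelle r W g := by
  funext x
  simp only [ruelle_eq_sum hr, Pi.add_apply, mul_add, Finset.sum_add_distrib]

theorem ruelle_smul (hr : ∀ x, (r ⁻¹' {x}).Finite) [CommSemiring 𝕜] [Inv 𝕜]
    (W f : X → 𝕜) (c : 𝕜) : ruelle r W (c • f) = c • ruelle r W f := by
  funext x
  simp only [ruelle_eq_sum hr, Pi.smul_apply, smul_eq_mul, mul_left_comm _ c, ← Finset.mul_sum]

theorem ruelle_one_one (hr : ∀ x, (r ⁻¹' {x}).Finite) (hs : Function.Surjective r) (x : X) :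
    ruelle r 1 (1 : X → ℝ≥0∞) x = 1 := by
  rw [ruelle_eq_sum hr]
  simp only [Pi.one_apply, mul_one, Finset.sum_const, nsmul_eq_mul]
  exact ENNReal.inv_mul_cancel (by exact_mod_cast card_fibre_ne_zero hr hs x)
    (ENNReal.natCast_ne_top _)

theorem ruelle_mono (hr : ∀ x, (r ⁻¹' {x}).Finite) {f g : X → ℝ≥0∞} {W : X → ℝ≥0∞} (x : X)
    (h : ∀ y, r y = x → f y ≤ g y) : ruelle r W f x ≤ ruelle r W g x := by
  rw [ruelle_eq_sum hr, ruelle_eq_sum hr]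
  gcongr with y hy
  exact h y (by simpa using hy)

theorem ruelle_iSup (hr : ∀ x, (r ⁻¹' {x}).Finite) (f : ℕ → X → ℝ≥0∞) (hf : Monotone f) (x : X) :
    ruelle r 1 (fun y => ⨆ n, f n y) x = ⨆ n, ruelle r 1 (f n) x := by
  simp only [ruelle_eq_sum hr, Pi.one_apply, one_mul, ← ENNReal.mul_iSup]
  rw [ENNReal.finsetSum_iSup_of_monotone]
  exact fun y m n hmn => hf hmn y

theorem ruelle_ofReal_eq_toReal (hr : ∀ x, (r ⁻¹' {x}).Finite) {G : X → ℝ} (hG : ∀ x, 0 ≤ G x)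
    (x : X) : ruelle r 1 (fun y => (G y : ℂ)) x =
      ((ruelle r 1 (fun y => ENNReal.ofReal (G y)) x).toReal : ℂ) := by
  simp only [ruelle_eq_sum hr, Pi.one_apply, one_mul, ENNReal.toReal_mul, ENNReal.toReal_inv,
    ENNReal.toReal_natCast]
  rw [ENNReal.toReal_sum (fun _ _ => ENNReal.ofReal_ne_top)]
  simp [ENNReal.toReal_ofReal, hG]

end Ruelle

/-! ### Measurability and integrals of fibre averages. -/

namespace IsFiniteCover

variable {X : Type*} [MeasurableSpace X] {r : X → X} {μ : Measure X}

/-- Measurability of a fibre average is not assumed; it is forced by invariance. Measurable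
minorants of the averages of `f` and `1 - f` with the same lower integrals have sum at most `1` and
total integral `∫ f + ∫ (1 - f) = 1`. So the sum is `1` almost everywhere, leaving no room between
an average and its minorant. -/
theorem aemeasurable_ruelle_of_le_one [IsProbabilityMeasure μ] (H : IsFiniteCover r μ)
    {f : X → ℝ≥0∞} (hf : Measurable f) (hf1 : ∀ x, f x ≤ 1) : AEMeasurable (ruelle r 1 f) μ := by
  obtain ⟨g₁, hg₁, hle₁, heq₁⟩ := exists_measurable_le_lintegral_eq μ (ruelle r 1 f)
  obtain ⟨g₂, hg₂, hle₂, heq₂⟩ :=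
    exists_measurable_le_lintegral_eq μ (ruelle r 1 fun x => 1 - f x)
  have hsum : ∀ x, ruelle r 1 f x + ruelle r 1 (fun x => 1 - f x) x = 1 := fun x => by
    rw [← Pi.add_apply, ← ruelle_add H.finite_fibre]
    convert ruelle_one_one H.finite_fibre H.surjective x using 2
    funext y
    exact add_tsub_cancel_of_le (hf1 y)
  have hle : ∀ x, g₁ x + g₂ x ≤ 1 := fun x => (hsum x) ▸ add_le_add (hle₁ x) (hle₂ x)
  have hint : ∫⁻ x, (g₁ x + g₂ x) ∂μ = 1 := by
    rw [lintegral_add_left hg₁, ← heq₁, ← heq₂, ← H.invariant f hf,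
      ← H.invariant (fun x => 1 - f x) (measurable_const.sub hf), ← lintegral_add_left hf]
    simp [add_tsub_cancel_of_le, hf1]
  have hae : (fun x => g₁ x + g₂ x) =ᵐ[μ] fun _ => 1 :=
    ae_eq_of_ae_le_of_lintegral_le (Eventually.of_forall hle) (by simp [hint])
      aemeasurable_const (by simp [hint])
  refine ⟨g₁, hg₁, ?_⟩
  filter_upwards [hae] with x hx
  refine le_antisymm ?_ (hle₁ x)
  have h2 : g₂ x ≠ ∞ := ((le_add_self.trans (hle x)).trans_lt ENNReal.one_lt_top).ne
  refine (ENNReal.add_le_add_iff_right h2).1 ?_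
  calc ruelle r 1 f x + g₂ x ≤ ruelle r 1 f x + ruelle r 1 (fun x => 1 - f x) x :=
        add_le_add le_rfl (hle₂ x)
    _ = g₁ x + g₂ x := by rw [hsum x, hx]

theorem aemeasurable_ruelle_of_measurable [IsProbabilityMeasure μ] (H : IsFiniteCover r μ)
    {f : X → ℝ≥0∞} (hf : Measurable f) : AEMeasurable (ruelle r 1 f) μ := by
  refine Measurable.ennreal_induction (motive := fun f => AEMeasurable (ruelle r 1 f) μ)
    (fun c s hs => ?_) (fun f g _ _ _ hf hg => ?_) (fun f _ hmono hf => ?_) hf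
  · have : (s.indicator fun _ => c) = c • s.indicator (1 : X → ℝ≥0∞) := by
      funext x
      by_cases hx : x ∈ s <;> simp [hx]
    rw [this, ruelle_smul H.finite_fibre]
    refine AEMeasurable.const_smul
      (H.aemeasurable_ruelle_of_le_one (measurable_one.indicator hs) ?_) c
    exact fun x => Set.indicator_le_self' (by simp) x
  · rw [ruelle_add H.finite_fibre]
    exact hf.add hg
  · have : (ruelle r 1 fun y => ⨆ n, f n y) = fun x => ⨆ n, ruelle r 1 (f n) x :=
      funext (ruelle_iSup H.finite_fibre f hmono)
    rw [this]
    exact AEMeasurable.iSup hf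

theorem measurePreserving [IsProbabilityMeasure μ] (H : IsFiniteCover r μ) :
    MeasurePreserving r μ μ := by
  refine ⟨H.measurable, Measure.ext_of_lintegral _ fun f hf => ?_⟩
  rw [lintegral_map hf H.measurable, H.invariant (fun x => f (r x)) (hf.comp H.measurable)]
  congr 1 with x
  have := ruelle_comp_mul H.finite_fibre 1 f 1 x
  simp only [Pi.one_apply, mul_one] at this
  rw [this, ruelle_one_one H.finite_fibre H.surjective, mul_one]

/-- The fibre average of the indicator of a null set has integral zero, so almost every fibre misses
that set. This is what makes `R` well defined on classes of functions. -/
theorem ae_fibre [IsProbabilityMeasure μ] (H : IsFiniteCover r μ) {p : X → Prop}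
    (hp : ∀ᵐ y ∂μ, p y) : ∀ᵐ x ∂μ, ∀ y, r y = x → p y := by
  obtain ⟨N, hN, hNm, hN0⟩ := exists_measurable_superset_of_null (ae_iff.1 hp)
  have h0 : ∫⁻ x, ruelle r 1 (N.indicator 1) x ∂μ = 0 := by
    rw [← H.invariant _ (measurable_one.indicator hNm), lintegral_indicator_one hNm, hN0]
  rw [lintegral_eq_zero_iff'
    (H.aemeasurable_ruelle_of_measurable (measurable_one.indicator hNm))] at h0
  filter_upwards [h0] with x hx y hy
  by_contra hpy
  rw [ruelle_eq_sum H.finite_fibre, Pi.zero_apply, mul_eq_zero] at hx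
  rcases hx with hx | hx
  · exact ENNReal.natCast_ne_top _ (ENNReal.inv_eq_zero.1 hx)
  · have := (Finset.sum_eq_zero_iff.1 hx) y (by simpa using hy)
    simp [hN (show y ∈ {a | ¬ p a} from hpy)] at this

theorem ruelle_congr_ae [IsProbabilityMeasure μ] (H : IsFiniteCover r μ) {𝕜 : Type*}
    [CommSemiring 𝕜] [Inv 𝕜] {W f g : X → 𝕜} (hfg : f =ᵐ[μ] g) :
    ruelle r W f =ᵐ[μ] ruelle r W g := by
  filter_upwards [H.ae_fibre hfg] with x hx
  exact ruelle_congr fun y hy => by rw [hx y hy]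

theorem aemeasurable_ruelle [IsProbabilityMeasure μ] (H : IsFiniteCover r μ)
    {f : X → ℝ≥0∞} (hf : AEMeasurable f μ) : AEMeasurable (ruelle r 1 f) μ :=
  (H.aemeasurable_ruelle_of_measurable hf.measurable_mk).congr (H.ruelle_congr_ae hf.ae_eq_mk.symm)

theorem lintegral_ruelle [IsProbabilityMeasure μ] (H : IsFiniteCover r μ)
    {f : X → ℝ≥0∞} (hf : AEMeasurable f μ) : ∫⁻ x, ruelle r 1 f x ∂μ = ∫⁻ x, f x ∂μ := by
  rw [lintegral_congr_ae hf.ae_eq_mk, H.invariant _ hf.measurable_mk,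
    lintegral_congr_ae (H.ruelle_congr_ae hf.ae_eq_mk)]

theorem integral_ruelle_ofReal [IsProbabilityMeasure μ] (H : IsFiniteCover r μ)
    {G : X → ℝ} (hG : ∀ x, 0 ≤ G x) (hi : Integrable G μ) :
    Integrable (ruelle r 1 (fun y => (G y : ℂ))) μ ∧
      ∫ x, ruelle r 1 (fun y => (G y : ℂ)) x ∂μ = ∫ x, (G x : ℂ) ∂μ := by
  have hm : AEMeasurable (fun y => ENNReal.ofReal (G y)) μ := hi.1.aemeasurable.ennreal_ofReal
  have hm' := H.aemeasurable_ruelle hm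
  have hl := H.lintegral_ruelle hm
  have hfin : ∫⁻ x, ENNReal.ofReal (G x) ∂μ ≠ ∞ := by
    rw [← ofReal_integral_eq_lintegral_ofReal hi (Eventually.of_forall hG)]
    exact ENNReal.ofReal_ne_top
  have he : ruelle r 1 (fun y => (G y : ℂ)) = fun x =>
      ((ruelle r 1 (fun y => ENNReal.ofReal (G y)) x).toReal : ℂ) :=
    funext (ruelle_ofReal_eq_toReal H.finite_fibre hG)
  rw [he]
  refine ⟨(integrable_toReal_of_lintegral_ne_top hm' (hl ▸ hfin)).ofReal, ?_⟩
  rw [integral_complex_ofReal, integral_complex_ofReal,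
    integral_toReal hm' (ae_lt_top' hm' (hl ▸ hfin)), hl,
    ← ofReal_integral_eq_lintegral_ofReal hi (Eventually.of_forall hG),
    ENNReal.toReal_ofReal (integral_nonneg hG)]

theorem integral_ruelle_add_smul (H : IsFiniteCover r μ) {F G : X → ℂ} (c : ℂ)
    (hF : Integrable F μ) (hG : Integrable G μ)
    (hF' : Integrable (ruelle r 1 F) μ ∧ ∫ x, ruelle r 1 F x ∂μ = ∫ x, F x ∂μ)
    (hG' : Integrable (ruelle r 1 G) μ ∧ ∫ x, ruelle r 1 G x ∂μ = ∫ x, G x ∂μ) :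
    Integrable (ruelle r 1 (F + c • G)) μ ∧
      ∫ x, ruelle r 1 (F + c • G) x ∂μ = ∫ x, (F + c • G) x ∂μ := by
  rw [ruelle_add H.finite_fibre, ruelle_smul H.finite_fibre]
  refine ⟨hF'.1.add (hG'.1.smul c), ?_⟩
  rw [integral_add' hF'.1 (hG'.1.smul c), integral_add' hF (hG.smul c)]
  simp only [Pi.smul_apply, integral_smul, hF'.2, hG'.2]

theorem integral_ruelle [IsProbabilityMeasure μ] (H : IsFiniteCover r μ)
    {F : X → ℂ} (hF : Integrable F μ) :
    Integrable (ruelle r 1 F) μ ∧ ∫ x, ruelle r 1 F x ∂μ = ∫ x, F x ∂μ := by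
  have key : ∀ (G : X → ℝ), Integrable G μ → Integrable (ruelle r 1 (fun y => (G y : ℂ))) μ ∧
      ∫ x, ruelle r 1 (fun y => (G y : ℂ)) x ∂μ = ∫ x, (G x : ℂ) ∂μ := fun G hG => by
    -- Positive and negative parts reduce the real case to the `[0, ∞]`-valued one.
    have e : (fun y => (G y : ℂ)) = (fun y => ((max (G y) 0 : ℝ) : ℂ)) +
        (-1 : ℂ) • fun y => ((max (-G y) 0 : ℝ) : ℂ) := by
      funext y
      have : G y = max (G y) 0 + -1 * max (-G y) 0 := by
        rcases le_total 0 (G y) with h | h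
        · simp [h]
        · simp [h]
      simp only [Pi.add_apply, Pi.smul_apply, smul_eq_mul]
      exact_mod_cast this
    have := H.integral_ruelle_add_smul (-1) hG.pos_part.ofReal hG.neg_part.ofReal
      (H.integral_ruelle_ofReal (fun _ => le_max_right _ _) hG.pos_part)
      (H.integral_ruelle_ofReal (fun _ => le_max_right _ _) hG.neg_part)
    exact e ▸ this
  have e : F = (fun y => ((RCLike.re (F y) : ℝ) : ℂ)) +
      Complex.I • fun y => ((RCLike.im (F y) : ℝ) : ℂ) := by
    funext y
    simp only [Pi.add_apply, Pi.smul_apply, smul_eq_mul, mul_comm Complex.I]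
    exact (Complex.re_add_im (F y)).symm
  rw [e]
  exact H.integral_ruelle_add_smul Complex.I hF.re.ofReal hF.im.ofReal (key _ hF.re) (key _ hF.im)

end IsFiniteCover

end Solenoid

namespace Solenoid

/-! ### Iterates of `R` and the laws of the coordinates. -/

section Weight

variable {X : Type*} {r : X → X} {m₀ : X → ℂ}

/-- The product `|m₀|² (|m₀|² ∘ r) ⋯ (|m₀|² ∘ rⁿ⁻¹)`. -/
noncomputable def iterWeight (r : X → X) (m₀ : X → ℂ) (n : ℕ) (x : X) : ℝ≥0∞ :=
  ∏ k ∈ Finset.range n, ‖m₀ (r^[k] x)‖ₑ ^ 2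

theorem iterWeight_zero : iterWeight r m₀ 0 = 1 := by
  funext x
  simp [iterWeight]

theorem iterWeight_succ (n : ℕ) (x : X) :
    iterWeight r m₀ (n + 1) x = iterWeight r m₀ n (r x) * ‖m₀ x‖ₑ ^ 2 := by
  simp [iterWeight, Finset.prod_range_succ']

theorem iterWeight_succ' (n : ℕ) (x : X) :
    iterWeight r m₀ (n + 1) x = iterWeight r m₀ n x * ‖m₀ (r^[n] x)‖ₑ ^ 2 := by
  simp [iterWeight, Finset.prod_range_succ]

theorem transferENN_eq : transferENN r m₀ = fun f => ruelle r 1 fun y => ‖m₀ y‖ₑ ^ 2 * f y := by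
  funext f
  exact ruelle_eq_ruelle_one _ _

theorem transfer_eq :
    transfer r m₀ = fun f => ruelle r 1 fun y => ((‖m₀ y‖ ^ 2 : ℝ) : ℂ) * f y := by
  funext f
  exact ruelle_eq_ruelle_one _ _

end Weight

variable {X : Type*} [MeasurableSpace X] {r : X → X} {μ : Measure X} [IsProbabilityMeasure μ]
  {m₀ : X → ℂ} {h : X → ℝ}

/-- The law of the `n`-th coordinate, `f ↦ ∫ Rⁿ(f h) dμ`, as a measure with density. -/
noncomputable def marginal (r : X → X) (μ : Measure X) (m₀ : X → ℂ) (h : X → ℝ) (n : ℕ) :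
    Measure X :=
  μ.withDensity fun x => iterWeight r m₀ n x * ENNReal.ofReal (h x)

omit [IsProbabilityMeasure μ] in
theorem marginal_absolutelyContinuous (n : ℕ) : marginal r μ m₀ h n ≪ μ :=
  withDensity_absolutelyContinuous _ _

omit [IsProbabilityMeasure μ] in
theorem IsPRFPair.aemeasurable_weight (hp : IsPRFPair r μ m₀ h) :
    AEMeasurable (fun x => ‖m₀ x‖ₑ ^ 2) μ :=
  hp.memLp.1.enorm.pow_const 2

omit [IsProbabilityMeasure μ] in
theorem IsPRFPair.aemeasurable_ofReal (hp : IsPRFPair r μ m₀ h) :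
    AEMeasurable (fun x => ENNReal.ofReal (h x)) μ :=
  hp.integrable.1.aemeasurable.ennreal_ofReal

theorem IsPRFPair.aemeasurable_iterWeight (hp : IsPRFPair r μ m₀ h) (H : IsFiniteCover r μ)
    (n : ℕ) : AEMeasurable (iterWeight r m₀ n) μ := by
  refine Finset.aemeasurable_fun_prod _ fun k _ => ?_
  exact hp.aemeasurable_weight.comp_quasiMeasurePreserving
    (H.measurePreserving.iterate k).quasiMeasurePreserving

theorem IsPRFPair.aemeasurable_density (hp : IsPRFPair r μ m₀ h) (H : IsFiniteCover r μ)
    (n : ℕ) : AEMeasurable (fun x => iterWeight r m₀ n x * ENNReal.ofReal (h x)) μ :=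
  (hp.aemeasurable_iterWeight H n).mul hp.aemeasurable_ofReal

theorem IsPRFPair.aemeasurable_transferENN (hp : IsPRFPair r μ m₀ h) (H : IsFiniteCover r μ)
    {g : X → ℝ≥0∞} (hg : AEMeasurable g μ) : AEMeasurable (transferENN r m₀ g) μ := by
  rw [transferENN_eq]
  exact H.aemeasurable_ruelle (hp.aemeasurable_weight.mul hg)

theorem IsPRFPair.aemeasurable_iterate_transferENN (hp : IsPRFPair r μ m₀ h)
    (H : IsFiniteCover r μ) (n : ℕ) {g : X → ℝ≥0∞} (hg : AEMeasurable g μ) :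
    AEMeasurable ((transferENN r m₀)^[n] g) μ := by
  induction n generalizing g with
  | zero => exact hg
  | succ n ih => exact ih (hp.aemeasurable_transferENN H hg)

/-- The adjointness relation: functions of `r y` are constant on fibres and leave the fibre average.
-/
theorem IsPRFPair.lintegral_comp_mul (hp : IsPRFPair r μ m₀ h) (H : IsFiniteCover r μ)
    {φ g : X → ℝ≥0∞} (hφ : AEMeasurable φ μ) (hg : AEMeasurable g μ) :
    ∫⁻ x, φ (r x) * (‖m₀ x‖ₑ ^ 2 * g x) ∂μ = ∫⁻ x, φ x * transferENN r m₀ g x ∂μ := by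
  rw [← H.lintegral_ruelle]
  · simp only [ruelle_comp_mul H.finite_fibre, transferENN_eq]
  · exact (hφ.comp_quasiMeasurePreserving H.measurePreserving.quasiMeasurePreserving).mul
      (hp.aemeasurable_weight.mul hg)

theorem IsPRFPair.lintegral_iterate_transferENN (hp : IsPRFPair r μ m₀ h)
    (H : IsFiniteCover r μ) (n : ℕ) {g : X → ℝ≥0∞} (hg : AEMeasurable g μ) :
    ∫⁻ x, (transferENN r m₀)^[n] g x ∂μ = ∫⁻ x, iterWeight r m₀ n x * g x ∂μ := by
  induction n generalizing g with
  | zero => simp [iterWeight_zero]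
  | succ n ih =>
    rw [Function.iterate_succ_apply, ih (hp.aemeasurable_transferENN H hg),
      ← hp.lintegral_comp_mul H (hp.aemeasurable_iterWeight H n) hg]
    simp only [iterWeight_succ, mul_assoc]

/-- Harmonicity is given for complex functions, while the laws use `[0, ∞]`-valued ones. Since
fibres are finite the averages are finite, so passing through `toReal` loses nothing. -/
theorem IsPRFPair.transferENN_ofReal (hp : IsPRFPair r μ m₀ h) (H : IsFiniteCover r μ) :
    transferENN r m₀ (fun x => ENNReal.ofReal (h x)) =ᵐ[μ] fun x => ENNReal.ofReal (h x) := by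
  filter_upwards [hp.harmonic, hp.nonneg, H.ae_fibre hp.nonneg] with x hx h0 hf
  -- `h` is nonnegative only almost everywhere; `max (h y) 0` agrees with it on almost every fibre
  -- and is nonnegative everywhere.
  have e1 : transfer r m₀ (fun x => (h x : ℂ)) x =
      ruelle r 1 (fun y => ((‖m₀ y‖ ^ 2 * max (h y) 0 : ℝ) : ℂ)) x := by
    rw [transfer_eq]
    refine ruelle_congr fun y hy => ?_
    have : 0 ≤ h y := hf y hy
    simp [this]
  rw [e1, ruelle_ofReal_eq_toReal H.finite_fibre (fun y => by positivity)] at hx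
  have hx' : (ruelle r 1 (fun y => ENNReal.ofReal (‖m₀ y‖ ^ 2 * max (h y) 0)) x).toReal = h x := by
    exact_mod_cast hx
  have e2 : (fun y => ENNReal.ofReal (‖m₀ y‖ ^ 2 * max (h y) 0)) =
      fun y => ‖m₀ y‖ₑ ^ 2 * ENNReal.ofReal (h y) := by
    funext y
    rw [ENNReal.ofReal_mul (by positivity), ENNReal.ofReal_pow (norm_nonneg _),
      ofReal_norm]
    congr 1
    rcases le_total 0 (h y) with h | h
    · simp [h]
    · simp [h, ENNReal.ofReal_of_nonpos h]
  rw [transferENN_eq, ← hx', ENNReal.ofReal_toReal]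
  · exact congrFun (congrArg (ruelle r 1) e2.symm) x
  rw [ruelle_eq_sum H.finite_fibre]
  refine ENNReal.mul_ne_top ?_ ?_
  · simpa using Finset.nonempty_iff_ne_empty.1
      (Finset.card_ne_zero.1 (card_fibre_ne_zero H.finite_fibre H.surjective x))
  · exact ENNReal.sum_ne_top.2 fun y _ =>
      ENNReal.mul_ne_top ENNReal.one_ne_top ENNReal.ofReal_ne_top

theorem IsPRFPair.iterate_transferENN_ofReal (hp : IsPRFPair r μ m₀ h) (H : IsFiniteCover r μ)
    (n : ℕ) : (transferENN r m₀)^[n] (fun x => ENNReal.ofReal (h x)) =ᵐ[μ]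
      fun x => ENNReal.ofReal (h x) := by
  induction n with
  | zero => rfl
  | succ n ih =>
    rw [Function.iterate_succ_apply']
    exact (H.ruelle_congr_ae ih).trans (hp.transferENN_ofReal H)

theorem IsPRFPair.lintegral_marginal (hp : IsPRFPair r μ m₀ h) (H : IsFiniteCover r μ) (n : ℕ)
    {f : X → ℝ≥0∞} (hf : AEMeasurable f μ) :
    ∫⁻ x, f x ∂(marginal r μ m₀ h n) =
      ∫⁻ x, iterWeight r m₀ n x * ENNReal.ofReal (h x) * f x ∂μ := by
  rw [marginal, lintegral_withDensity_eq_lintegral_mul₀ (hp.aemeasurable_density H n) hf]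
  rfl

theorem IsPRFPair.lintegral_marginal' (hp : IsPRFPair r μ m₀ h) (H : IsFiniteCover r μ) (n : ℕ)
    {f : X → ℝ≥0∞} (hf : AEMeasurable f μ) :
    ∫⁻ x, f x ∂(marginal r μ m₀ h n) =
      ∫⁻ x, (transferENN r m₀)^[n] (fun y => f y * ENNReal.ofReal (h y)) x ∂μ := by
  rw [hp.lintegral_marginal H n hf,
    hp.lintegral_iterate_transferENN H n (g := fun y => f y * ENNReal.ofReal (h y))
      (hf.mul hp.aemeasurable_ofReal)]
  congr 1 with x
  ring

theorem IsPRFPair.hasMarginals_iff (hp : IsPRFPair r μ m₀ h) (H : IsFiniteCover r μ)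
    (ν : Measure (Sol r)) :
    HasMarginals r μ m₀ h ν ↔ ∀ n, ν.map (θ r n) = marginal r μ m₀ h n := by
  refine ⟨fun hν n => Measure.ext_of_lintegral _ fun f hf => ?_, fun hν n f hf => ?_⟩
  · rw [hν n f hf, hp.lintegral_marginal' H n hf.aemeasurable]
  · rw [hν n, hp.lintegral_marginal' H n hf.aemeasurable]

/-- Adjointness moves one factor `|m₀|²` into `R`, and `R h = h` absorbs it. -/
theorem IsPRFPair.map_marginal (hp : IsPRFPair r μ m₀ h) (H : IsFiniteCover r μ) (n : ℕ) :
    (marginal r μ m₀ h (n + 1)).map r = marginal r μ m₀ h n := by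
  refine Measure.ext_of_lintegral _ fun f hf => ?_
  rw [lintegral_map hf H.measurable, hp.lintegral_marginal H (n + 1)
    (f := fun x => f (r x)) (hf.comp H.measurable).aemeasurable, hp.lintegral_marginal H n hf.aemeasurable]
  have e := hp.lintegral_comp_mul H
    ((hp.aemeasurable_iterWeight H n).mul hf.aemeasurable) hp.aemeasurable_ofReal
  calc _ = _ := lintegral_congr fun x => by simp only [iterWeight_succ, Pi.mul_apply]; ring
    _ = _ := e
    _ = _ := lintegral_congr_ae (by
      filter_upwards [hp.transferENN_ofReal H] with x hx
      rw [hx, Pi.mul_apply]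
      ring)

theorem IsPRFPair.isFiniteMeasure_marginal (hp : IsPRFPair r μ m₀ h) (H : IsFiniteCover r μ)
    (n : ℕ) : IsFiniteMeasure (marginal r μ m₀ h n) := by
  induction n with
  | zero =>
    refine isFiniteMeasure_withDensity ?_
    simp only [iterWeight_zero, Pi.one_apply, one_mul]
    exact hp.integrable.lintegral_lt_top.ne
  | succ n ih =>
    refine ⟨?_⟩
    have := measure_lt_top (marginal r μ m₀ h n) Set.univ
    rwa [← hp.map_marginal H n, Measure.map_apply H.measurable .univ, Set.preimage_univ] at this

theorem IsPRFPair.ae_marginal (hp : IsPRFPair r μ m₀ h) (H : IsFiniteCover r μ) (n : ℕ)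
    {p : X → Prop} (hx : ∀ᵐ x ∂μ, 0 < h x → p x) : ∀ᵐ x ∂(marginal r μ m₀ h n), p x := by
  rw [marginal, ae_withDensity_iff' (hp.aemeasurable_density H n)]
  filter_upwards [hx] with x hx h0
  refine hx ?_
  by_contra hneg
  simp [ENNReal.ofReal_of_nonpos (not_lt.1 hneg)] at h0

/-- At index `0` the density is `h` alone, so the converse of `ae_marginal` needs nothing about
zeros of `m₀`. -/
theorem IsPRFPair.ae_of_ae_marginal_zero (hp : IsPRFPair r μ m₀ h) (H : IsFiniteCover r μ)
    {p : X → Prop} (hx : ∀ᵐ x ∂(marginal r μ m₀ h 0), p x) : ∀ᵐ x ∂μ, 0 < h x → p x := by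
  rw [marginal, ae_withDensity_iff' (hp.aemeasurable_density H 0)] at hx
  filter_upwards [hx] with x hx h0
  exact hx (by simpa [iterWeight_zero] using h0)

end Solenoid

namespace Solenoid

/-! ### The projective limit, its shift and its cylinders. -/

section Sol

variable {X : Type*} {r : X → X}

theorem θ_succ (n : ℕ) (x : Sol r) : r (θ r (n + 1) x) = θ r n x := x.2 n

theorem iterate_θ (n k : ℕ) (x : Sol r) : r^[k] (θ r (n + k) x) = θ r n x := by
  induction k with
  | zero => rfl
  | succ k ih => rw [Function.iterate_succ_apply, ← add_assoc, θ_succ (r := r), ih]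

theorem θ_rhat_succ (n : ℕ) (x : Sol r) : θ r (n + 1) (rhat r x) = θ r n x := rfl

theorem Sol.ext {x y : Sol r} (h : ∀ n, θ r n x = θ r n y) : x = y :=
  Subtype.ext (funext h)

theorem θ_zero_surjective (hr : Function.Surjective r) : Function.Surjective (θ r 0) := by
  intro x
  choose s hs using hr
  exact ⟨⟨fun n => s^[n] x, fun n => by
    simp only [Function.iterate_succ_apply', hs]⟩, rfl⟩

theorem θ_surjective (hr : Function.Surjective r) (n : ℕ) : Function.Surjective (θ r n) := by
  induction n with
  | zero => exact θ_zero_surjective hr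
  | succ n ih =>
    intro x
    obtain ⟨y, hy⟩ := ih x
    exact ⟨rhat r y, hy⟩

/-- The inverse of `rhat`, dropping the first coordinate. -/
def shift (r : X → X) (x : Sol r) : Sol r := ⟨fun n => x.1 (n + 1), fun n => x.2 (n + 1)⟩

theorem shift_rhat (x : Sol r) : shift r (rhat r x) = x := Sol.ext fun _ => rfl

theorem rhat_shift (x : Sol r) : rhat r (shift r x) = x := by
  refine Sol.ext fun n => ?_
  cases n with
  | zero => exact x.2 0
  | succ n => rfl

/-- The fibres of `θ₀` are compact for the discrete topology on `X`: a decreasing sequence of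
cylinders with empty intersection eventually misses a given fibre. -/
theorem exists_cylinder_fibre_empty (hr : ∀ x, (r ⁻¹' {x}).Finite) (N : ℕ → ℕ) (A : ℕ → Set X)
    (hanti : Antitone fun k => θ r (N k) ⁻¹' A k) (hempty : ⋂ k, θ r (N k) ⁻¹' A k = ∅) (x : X) :
    ∃ k, ∀ s : Sol r, θ r 0 s = x → θ r (N k) s ∉ A k := by
  by_contra! hcon
  -- The discrete topology makes every `A k` closed and `r` continuous, while finite sets stay
  -- compact.
  let _ : TopologicalSpace X := ⊥
  have : DiscreteTopology X := ⟨rfl⟩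
  have hfin : ∀ n, (r^[n] ⁻¹' {x}).Finite := fun n => by
    induction n with
    | zero => simp
    | succ n ih =>
      rw [Function.iterate_succ, Set.preimage_comp]
      exact ih.preimage' fun y _ => hr y
  let K : ℕ → Set (ℕ → X) := fun k =>
    {s | s 0 = x} ∩ {s | ∀ n, r (s (n + 1)) = s n} ∩ {s | s (N k) ∈ A k}
  have hclosed : ∀ k, IsClosed (K k) := fun k => by
    refine IsClosed.inter (IsClosed.inter ?_ ?_) ?_
    · exact isClosed_eq (continuous_apply 0) continuous_const
    · rw [Set.ofPred_forall]
      exact isClosed_iInter fun n => isClosed_eq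
        ((continuous_of_discreteTopology (f := r)).comp (continuous_apply (n + 1)))
        (continuous_apply n)
    · exact (isClosed_discrete (A k)).preimage (continuous_apply (N k))
  -- A path over `x` has its `n`-th coordinate in the finite set `r⁻ⁿ(x)`, so Tychonoff applies.
  have hcompact : IsCompact (K 0) := by
    refine (isCompact_univ_pi fun n => (hfin n).isCompact).of_isClosed_subset (hclosed 0) ?_
    rintro s ⟨⟨h0, hs⟩, -⟩ n -
    have := iterate_θ 0 n (⟨s, hs⟩ : Sol r)
    rw [zero_add] at this
    exact this.trans h0
  have hsucc : ∀ k, K (k + 1) ⊆ K k := fun k s hs =>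
    ⟨hs.1, hanti (Nat.le_succ k) (show (⟨s, hs.1.2⟩ : Sol r) ∈ _ from hs.2)⟩
  obtain ⟨s, hs⟩ := IsCompact.nonempty_iInter_of_sequence_nonempty_isCompact_isClosed K hsucc
    (fun k => let ⟨s, hs⟩ := hcon k; ⟨s.1, ⟨hs.1, s.2⟩, hs.2⟩) hcompact hclosed
  rw [Set.mem_iInter] at hs
  have : (⟨s, (hs 0).1.2⟩ : Sol r) ∈ ⋂ k, θ r (N k) ⁻¹' A k :=
    Set.mem_iInter.2 fun k => (hs k).2
  rw [hempty] at this
  exact this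

theorem measurable_shift [MeasurableSpace X] : Measurable (shift r) :=
  Measurable.subtype_mk (measurable_pi_lambda _ fun n => measurable_θ r (n + 1))

theorem measurable_rhat [MeasurableSpace X] (hr : Measurable r) : Measurable (rhat r) := by
  refine Measurable.subtype_mk (measurable_pi_lambda _ fun n => ?_)
  cases n with
  | zero => exact hr.comp (measurable_θ r 0)
  | succ n => exact measurable_θ r n

variable [MeasurableSpace X]

/-- The sets depending measurably on one coordinate. -/
def cylinders (r : X → X) : Set (Set (Sol r)) :=
  {C | ∃ n A, MeasurableSet A ∧ C = θ r n ⁻¹' A}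

omit [MeasurableSpace X] in
theorem preimage_θ_eq (n k : ℕ) (A : Set X) :
    θ r n ⁻¹' A = θ r (n + k) ⁻¹' (r^[k] ⁻¹' A) := by
  ext x
  simp only [Set.mem_preimage, iterate_θ]

theorem exists_common_index (hr : Measurable r) {C D : Set (Sol r)} (hC : C ∈ cylinders r)
    (hD : D ∈ cylinders r) : ∃ n A B, MeasurableSet A ∧ MeasurableSet B ∧ C = θ r n ⁻¹' A ∧
      D = θ r n ⁻¹' B := by
  obtain ⟨n, A, hA, rfl⟩ := hC
  obtain ⟨m, B, hB, rfl⟩ := hD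
  refine ⟨n + m, _, _, (hr.iterate m) hA, (hr.iterate n) hB, preimage_θ_eq n m A, ?_⟩
  rw [add_comm]
  exact preimage_θ_eq m n B

theorem isSetRing_cylinders (hr : Measurable r) : IsSetRing (cylinders r) where
  empty_mem := ⟨0, ∅, .empty, rfl⟩
  union_mem C D hC hD := by
    obtain ⟨n, A, B, hA, hB, rfl, rfl⟩ := exists_common_index hr hC hD
    exact ⟨n, A ∪ B, hA.union hB, rfl⟩
  sdiff_mem C D hC hD := by
    obtain ⟨n, A, B, hA, hB, rfl, rfl⟩ := exists_common_index hr hC hD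
    exact ⟨n, A \ B, hA.diff hB, rfl⟩

theorem generateFrom_cylinders :
    (inferInstance : MeasurableSpace (Sol r)) = MeasurableSpace.generateFrom (cylinders r) := by
  refine le_antisymm ?_ (MeasurableSpace.generateFrom_le ?_)
  · have : @Measurable (Sol r) (ℕ → X) (MeasurableSpace.generateFrom (cylinders r)) _
        Subtype.val :=
      @measurable_pi_lambda (Sol r) ℕ (fun _ => X) (MeasurableSpace.generateFrom (cylinders r)) _ _
        fun n A hA => MeasurableSpace.measurableSet_generateFrom ⟨n, A, hA, rfl⟩
    exact this.comap_le
  · rintro _ ⟨n, A, hA, rfl⟩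
    exact measurable_θ r n hA

theorem measure_ext_of_map_θ (hr : Measurable r) {ν ν' : Measure (Sol r)} [IsFiniteMeasure ν]
    (h : ∀ n, ν.map (θ r n) = ν'.map (θ r n)) : ν = ν' := by
  have hap : ∀ n A, MeasurableSet A → ν (θ r n ⁻¹' A) = ν' (θ r n ⁻¹' A) := fun n A hA => by
    rw [← Measure.map_apply (measurable_θ r n) hA, h, Measure.map_apply (measurable_θ r n) hA]
  refine ext_of_generate_finite _ generateFrom_cylinders
    (isSetRing_cylinders hr).isSetSemiring.isPiSystem ?_ (hap 0 Set.univ .univ)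
  rintro _ ⟨n, A, hA, rfl⟩
  exact hap n A hA

end Sol

/-! ### Extension of consistent laws to the projective limit. -/

section Extension

variable {X : Type*} [MeasurableSpace X] {r : X → X}

/-- A consistent family of laws of the coordinates that is continuous at `∅` along cylinders is the
family of marginals of a measure on the projective limit. -/
theorem exists_measure_of_consistent (hr : Measurable r) (hs : Function.Surjective r)
    (ω : ℕ → Measure X) [∀ n, IsFiniteMeasure (ω n)] (hω : ∀ n, (ω (n + 1)).map r = ω n)
    (hcont : ∀ (N : ℕ → ℕ) (A : ℕ → Set X), (∀ k, MeasurableSet (A k)) →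
      (Antitone fun k => θ r (N k) ⁻¹' A k) → ⋂ k, θ r (N k) ⁻¹' A k = ∅ →
      Tendsto (fun k => ω (N k) (A k)) atTop (𝓝 0)) :
    ∃ ν : Measure (Sol r), ∀ n, ν.map (θ r n) = ω n := by
  classical
  have hω' : ∀ n k A, MeasurableSet A → ω (n + k) (r^[k] ⁻¹' A) = ω n A := fun n k => by
    induction k with
    | zero => intros; rfl
    | succ k ih =>
      intro A hA
      rw [Function.iterate_succ, Set.preimage_comp, ← add_assoc,
        ← Measure.map_apply hr ((hr.iterate k) hA), hω, ih A hA]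
  let m : Set (Sol r) → ℝ≥0∞ := fun C =>
    if hC : C ∈ cylinders r then ω hC.choose hC.choose_spec.choose else 0
  have hm : ∀ n A, MeasurableSet A → m (θ r n ⁻¹' A) = ω n A := fun n A hA => by
    have hC : θ r n ⁻¹' A ∈ cylinders r := ⟨n, A, hA, rfl⟩
    simp only [m, dif_pos hC]
    obtain ⟨hB, heq⟩ := hC.choose_spec.choose_spec
    generalize hC.choose_spec.choose = B at hB heq
    generalize hC.choose = k at heq
    -- Independence of the chosen description: both are pulled back to coordinate `n + k`, where
    -- surjectivity of `θ` makes the base sets equal.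
    rw [preimage_θ_eq n k, preimage_θ_eq k n, add_comm k n] at heq
    have := (θ_surjective hs (n + k)).preimage_injective heq
    rw [← hω' k n B hB, ← hω' n k A hA, this, add_comm]
  have hring := isSetRing_cylinders hr
  let c : AddContent ℝ≥0∞ (cylinders r) := hring.addContent_of_union m
    ((hm 0 ∅ .empty).trans (by simp)) (by
      intro C D hC hD hdisj
      obtain ⟨n, A, B, hA, hB, rfl, rfl⟩ := exists_common_index hr hC hD
      rw [← Set.preimage_union, hm _ _ hA, hm _ _ hB, hm _ _ (hA.union hB), measure_union _ hB]
      exact (Set.disjoint_preimage_iff (θ_surjective hs n)).1 hdisj)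
  have hc : ∀ n A, MeasurableSet A → c (θ r n ⁻¹' A) = ω n A := hm
  -- On a ring of sets, a finite content that is continuous at `∅` is countably additive.
  have hsub : c.IsSigmaSubadditive := by
    refine isSigmaSubadditive_of_addContent_iUnion_eq_tsum hring ?_
    refine addContent_iUnion_eq_sum_of_tendsto_zero hring c ?_ ?_
    · rintro _ ⟨n, A, hA, rfl⟩
      rw [hc n A hA]
      exact measure_ne_top _ _
    · intro C hC hanti hempty
      choose N A hA hCA using hC
      obtain rfl : C = fun k => θ r (N k) ⁻¹' A k := funext hCA
      simp only [hc _ _ (hA _)]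
      exact hcont N A hA hanti hempty
  refine ⟨c.measure hring.isSetSemiring generateFrom_cylinders.le hsub, fun n => ?_⟩
  ext A hA
  rw [Measure.map_apply (measurable_θ r n) hA, c.measure_eq _ generateFrom_cylinders _
    ⟨n, A, hA, rfl⟩, hc n A hA]

variable {μ : Measure X} [IsProbabilityMeasure μ] {m₀ : X → ℂ} {h : X → ℝ}

omit [MeasurableSpace X] in
theorem iterate_transferENN_eq_zero (hr : ∀ x, (r ⁻¹' {x}).Finite) (n : ℕ) {g : X → ℝ≥0∞} {x : X}
    (hg : ∀ y, r^[n] y = x → g y = 0) : (transferENN r m₀)^[n] g x = 0 := by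
  induction n generalizing g with
  | zero => exact hg x rfl
  | succ n ih =>
    refine ih fun y hy => ?_
    rw [transferENN_eq]
    simp only [ruelle_eq_sum hr, Pi.one_apply, one_mul]
    rw [Finset.sum_eq_zero, mul_zero]
    intro z hz
    have hz : r z = y := by simpa using hz
    rw [hg z (by rw [Function.iterate_succ_apply, hz, hy]), mul_zero]

omit [MeasurableSpace X] in
theorem iterate_transferENN_mono (hr : ∀ x, (r ⁻¹' {x}).Finite) (n : ℕ) {f g : X → ℝ≥0∞}
    (hfg : f ≤ g) : (transferENN r m₀)^[n] f ≤ (transferENN r m₀)^[n] g :=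
  by
  have : Monotone (transferENN r m₀) := fun f g hfg x => ruelle_mono hr x fun y _ => hfg y
  exact this.iterate n hfg

/-- The mass of a cylinder is the integral of `Rᴺ(1_A h)`, which is at most `Rᴺ h = h`. At `x` this
function sees only paths starting at `x`, so it is eventually zero along cylinders shrinking to `∅`;
dominated convergence concludes. -/
theorem IsPRFPair.exists_measure (hp : IsPRFPair r μ m₀ h) (H : IsFiniteCover r μ) :
    ∃ ν : Measure (Sol r), ∀ n, ν.map (θ r n) = marginal r μ m₀ h n := by
  have := hp.isFiniteMeasure_marginal H
  refine exists_measure_of_consistent H.measurable H.surjective _ (hp.map_marginal H) ?_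
  intro N A hA hanti hempty
  let G : ℕ → X → ℝ≥0∞ := fun k => (transferENN r m₀)^[N k]
    (fun y => (A k).indicator 1 y * ENNReal.ofReal (h y))
  have hG : ∀ k, marginal r μ m₀ h (N k) (A k) = ∫⁻ x, G k x ∂μ := fun k => by
    rw [← lintegral_indicator_one (hA k),
      hp.lintegral_marginal' H _ (measurable_one.indicator (hA k)).aemeasurable]
  simp only [hG]
  have := tendsto_lintegral_of_dominated_convergence' (μ := μ) (F := G) (f := 0)
    (fun x => ENNReal.ofReal (h x)) ?_ ?_ hp.integrable.lintegral_lt_top.ne ?_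
  · simpa using this
  · exact fun k => hp.aemeasurable_iterate_transferENN H _
      ((measurable_one.indicator (hA k)).aemeasurable.mul hp.aemeasurable_ofReal)
  · intro k
    filter_upwards [hp.iterate_transferENN_ofReal H (N k)] with x hx
    rw [← hx]
    refine iterate_transferENN_mono H.finite_fibre _ (fun y => ?_) x
    exact mul_le_of_le_one_left zero_le (Set.indicator_le_self' (by simp) y)
  · refine Eventually.of_forall fun x => ?_
    obtain ⟨K, hK⟩ := exists_cylinder_fibre_empty H.finite_fibre N A hanti hempty x
    refine tendsto_const_nhds.congr' ?_
    filter_upwards [eventually_ge_atTop K] with k hk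
    refine (iterate_transferENN_eq_zero H.finite_fibre _ fun y hy => ?_).symm
    obtain ⟨s, rfl⟩ := θ_surjective H.surjective (N k) y
    have hs0 : θ r 0 s = x := by rw [← hy, ← iterate_θ 0 (N k), zero_add]
    have : θ r (N k) s ∉ A k := fun hs => hK s hs0 (hanti hk hs)
    simp [this]

end Extension

end Solenoid

/-! ### Behaviour of the path measure under `r̂` and its inverse. -/

namespace Solenoid

/-- The data of the measure `ν` on the projective limit attached to a non-singular
Perron–Ruelle–Frobenius pair. -/
structure IsPathSystem {X : Type*} [MeasurableSpace X] (r : X → X) (μ : Measure X) (m₀ : X → ℂ)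
    (h : X → ℝ) (ν : Measure (Sol r)) : Prop where
  cover : IsFiniteCover r μ
  pair : IsPRFPair r μ m₀ h
  nonsingular : ∀ᵐ x ∂μ, m₀ x ≠ 0
  map_θ : ∀ n, ν.map (θ r n) = marginal r μ m₀ h n

namespace IsPathSystem

variable {X : Type*} [MeasurableSpace X] {r : X → X} {μ : Measure X} [IsProbabilityMeasure μ]
  {m₀ : X → ℂ} {h : X → ℝ} {ν : Measure (Sol r)}

theorem isFiniteMeasure (S : IsPathSystem r μ m₀ h ν) : IsFiniteMeasure ν := by
  have := S.pair.isFiniteMeasure_marginal S.cover 0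
  refine ⟨?_⟩
  have := measure_lt_top (marginal r μ m₀ h 0) Set.univ
  rwa [← S.map_θ 0, Measure.map_apply (measurable_θ r 0) .univ, Set.preimage_univ] at this

omit [IsProbabilityMeasure μ] in
theorem quasiMeasurePreserving_θ (S : IsPathSystem r μ m₀ h ν) (n : ℕ) :
    Measure.QuasiMeasurePreserving (θ r n) ν μ :=
  ⟨measurable_θ r n, S.map_θ n ▸ marginal_absolutelyContinuous n⟩

theorem ae_θ (S : IsPathSystem r μ m₀ h ν) (n : ℕ) {p : X → Prop}
    (hx : ∀ᵐ x ∂μ, 0 < h x → p x) : ∀ᵐ x ∂ν, p (θ r n x) :=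
  ae_of_ae_map (measurable_θ r n).aemeasurable
    (S.map_θ n ▸ S.pair.ae_marginal S.cover n hx)

theorem ae_of_ae_θ_zero (S : IsPathSystem r μ m₀ h ν) {p : X → Prop}
    (hp : MeasurableSet {x | p x}) (hx : ∀ᵐ x ∂ν, p (θ r 0 x)) : ∀ᵐ x ∂μ, 0 < h x → p x := by
  rw [← ae_map_iff (measurable_θ r 0).aemeasurable hp, S.map_θ 0] at hx
  exact S.pair.ae_of_ae_marginal_zero S.cover hx

omit [IsProbabilityMeasure μ] in
theorem ae_ne_zero (S : IsPathSystem r μ m₀ h ν) : ∀ᵐ x ∂ν, m₀ (θ r 0 x) ≠ 0 :=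
  (S.quasiMeasurePreserving_θ 0).ae S.nonsingular

omit [IsProbabilityMeasure μ] in
theorem aestronglyMeasurable_m₀ (S : IsPathSystem r μ m₀ h ν) :
    AEStronglyMeasurable (fun x => m₀ (θ r 0 x)) ν :=
  S.pair.memLp.1.comp_quasiMeasurePreserving (S.quasiMeasurePreserving_θ 0)

omit [IsProbabilityMeasure μ] in
theorem aemeasurable_weight (S : IsPathSystem r μ m₀ h ν) :
    AEMeasurable (fun x => ‖m₀ (θ r 0 x)‖ₑ ^ 2) ν :=
  S.aestronglyMeasurable_m₀.enorm.pow_const 2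

/-- It suffices to compare coordinate laws. Under `r̂` coordinate `n + 1` becomes `θ_n`, and passing
from law `n` to law `n + 1` multiplies the density by `|m₀ ∘ rⁿ|²`, which along a path is `|m₀ ∘
θ₀|²`. Coordinate `0` follows as the image of coordinate `1` under `r`. -/
theorem map_rhat (S : IsPathSystem r μ m₀ h ν) :
    (ν.withDensity fun x => ‖m₀ (θ r 0 x)‖ₑ ^ 2).map (rhat r) = ν := by
  have := S.isFiniteMeasure
  have hm := measurable_rhat S.cover.measurable
  have key : ∀ n, ν.map (θ r (n + 1)) =
      ((ν.withDensity fun x => ‖m₀ (θ r 0 x)‖ₑ ^ 2).map (rhat r)).map (θ r (n + 1)) := fun n => by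
    rw [S.map_θ]
    refine Measure.ext_of_lintegral _ fun f hf => ?_
    have hw : AEMeasurable (fun x => ‖m₀ (r^[n] x)‖ₑ ^ 2) μ :=
      S.pair.aemeasurable_weight.comp_quasiMeasurePreserving
        (S.cover.measurePreserving.iterate n).quasiMeasurePreserving
    have hG : AEMeasurable (fun x => ‖m₀ (r^[n] x)‖ₑ ^ 2 * f x) μ := hw.mul hf.aemeasurable
    rw [lintegral_map hf (measurable_θ r _), lintegral_map (f := fun x => f (θ r (n + 1) x)) (hf.comp (measurable_θ r _)) hm,
      lintegral_withDensity_eq_lintegral_mul₀ S.aemeasurable_weight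
        (g := fun x => f (θ r (n + 1) (rhat r x)))
        ((hf.comp (measurable_θ r _)).comp hm).aemeasurable,
      S.pair.lintegral_marginal S.cover _ hf.aemeasurable]
    calc _ = ∫⁻ x, ‖m₀ (r^[n] x)‖ₑ ^ 2 * f x ∂(marginal r μ m₀ h n) := by
          rw [S.pair.lintegral_marginal S.cover _ hG]
          refine lintegral_congr fun x => ?_
          rw [iterWeight_succ']
          ring
      _ = ∫⁻ x, ‖m₀ (r^[n] (θ r n x))‖ₑ ^ 2 * f (θ r n x) ∂ν := by
          rw [← S.map_θ n, lintegral_map' _ (measurable_θ r n).aemeasurable]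
          rw [S.map_θ n]
          exact hG.mono_ac (marginal_absolutelyContinuous n)
      _ = _ := lintegral_congr fun x => by
          have := iterate_θ 0 n x
          rw [zero_add] at this
          simp only [this, Pi.mul_apply, θ_rhat_succ]
  refine (measure_ext_of_map_θ S.cover.measurable fun n => ?_).symm
  cases n with
  | succ n => exact key n
  | zero =>
    have e : θ r 0 = r ∘ θ r 1 := funext fun x => (θ_succ (r := r) 0 x).symm
    have e' : ∀ κ : Measure (Sol r), κ.map (θ r 0) = (κ.map (θ r 1)).map r := fun κ => by
      rw [e, Measure.map_map S.cover.measurable (measurable_θ r 1)]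
    rw [e', key 0, ← e']

-- Non-singularity enters here: a density without zeros loses no null sets, so composition with `r̂`
-- respects almost everywhere equality.
omit [IsProbabilityMeasure μ] in
theorem absolutelyContinuous_withDensity (S : IsPathSystem r μ m₀ h ν) :
    ν ≪ ν.withDensity fun x => ‖m₀ (θ r 0 x)‖ₑ ^ 2 := by
  refine withDensity_absolutelyContinuous' S.aemeasurable_weight ?_
  filter_upwards [S.ae_ne_zero] with x hx
  simpa using hx

theorem quasiMeasurePreserving_rhat (S : IsPathSystem r μ m₀ h ν) :
    Measure.QuasiMeasurePreserving (rhat r) ν ν := by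
  refine ⟨measurable_rhat S.cover.measurable, ?_⟩
  conv_rhs => rw [← S.map_rhat]
  exact S.absolutelyContinuous_withDensity.map (measurable_rhat S.cover.measurable)

theorem map_shift (S : IsPathSystem r μ m₀ h ν) :
    ν.map (shift r) = ν.withDensity fun x => ‖m₀ (θ r 0 x)‖ₑ ^ 2 := by
  conv_lhs => rw [← S.map_rhat]
  rw [Measure.map_map measurable_shift (measurable_rhat S.cover.measurable)]
  have : shift r ∘ rhat r = id := funext shift_rhat
  rw [this, Measure.map_id]

theorem quasiMeasurePreserving_shift (S : IsPathSystem r μ m₀ h ν) :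
    Measure.QuasiMeasurePreserving (shift r) ν ν :=
  ⟨measurable_shift, S.map_shift ▸ withDensity_absolutelyContinuous _ _⟩

theorem lintegral_rhat (S : IsPathSystem r μ m₀ h ν) {F : Sol r → ℝ≥0∞} (hF : AEMeasurable F ν) :
    ∫⁻ x, ‖m₀ (θ r 0 x)‖ₑ ^ 2 * F (rhat r x) ∂ν = ∫⁻ x, F x ∂ν := by
  have hm := measurable_rhat S.cover.measurable
  conv_rhs => rw [← S.map_rhat]
  rw [lintegral_map' (S.map_rhat.symm ▸ hF) hm.aemeasurable,
    lintegral_withDensity_eq_lintegral_mul₀ S.aemeasurable_weight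
      (g := fun x => F (rhat r x)) (hF.comp_quasiMeasurePreserving S.quasiMeasurePreserving_rhat)]
  rfl

theorem setIntegral_rhat (S : IsPathSystem r μ m₀ h ν) {s : Set (Sol r)} (hs : MeasurableSet s)
    {F : Sol r → ℂ} (hF : AEStronglyMeasurable F ν) :
    ∫ x in s, F x ∂ν = ∫ x in rhat r ⁻¹' s, (‖m₀ (θ r 0 x)‖ ^ 2) • F (rhat r x) ∂ν := by
  have hm := measurable_rhat S.cover.measurable
  conv_lhs => rw [← S.map_rhat]
  rw [setIntegral_map hs (S.map_rhat.symm ▸ hF) hm.aemeasurable, restrict_withDensity (hm hs),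
    integral_withDensity_eq_integral_toReal_smul₀ S.aemeasurable_weight.restrict]
  · simp
  · exact Eventually.of_forall fun x => by simp

theorem integrable_weight (S : IsPathSystem r μ m₀ h ν) :
    Integrable (fun x => ‖m₀ (θ r 0 x)‖ ^ 2) ν := by
  have := S.isFiniteMeasure
  refine ⟨S.aestronglyMeasurable_m₀.norm.pow 2, ?_⟩
  have := S.lintegral_rhat (F := 1) aemeasurable_const
  simp only [Pi.one_apply, mul_one] at this
  simp only [HasFiniteIntegral, enorm_pow, enorm_norm, this]
  simp

end IsPathSystem

/-! ### Conditioning on coordinates. -/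

section Filtration

variable {X : Type*} [MeasurableSpace X] {r : X → X}

/-- The filtration generated by the coordinates. -/
def coordFiltration (hr : Measurable r) :
    Filtration ℕ (inferInstance : MeasurableSpace (Sol r)) where
  seq n := MeasurableSpace.comap (θ r n) inferInstance
  mono' := by
    refine monotone_nat_of_le_succ fun n => ?_
    rintro _ ⟨A, hA, rfl⟩
    refine ⟨r ⁻¹' A, hr hA, ?_⟩
    ext x
    simp [θ_succ (r := r)]
  le' n := (measurable_θ r n).comap_le

theorem iSup_coordFiltration (hr : Measurable r) :
    ⨆ n, coordFiltration hr n = (inferInstance : MeasurableSpace (Sol r)) := by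
  refine le_antisymm (iSup_le (coordFiltration hr).le) ?_
  refine generateFrom_cylinders.le.trans (MeasurableSpace.generateFrom_le ?_)
  rintro _ ⟨n, A, hA, rfl⟩
  exact le_iSup (coordFiltration hr) n _ ⟨A, hA, rfl⟩

theorem measurable_coordFiltration (hr : Measurable r) (n : ℕ) :
    Measurable[coordFiltration hr n] (θ r n) := fun A hA => ⟨A, hA, rfl⟩

end Filtration

namespace IsPathSystem

variable {X : Type*} [MeasurableSpace X] {r : X → X} {μ : Measure X} [IsProbabilityMeasure μ]
  {m₀ : X → ℂ} {h : X → ℝ} {ν : Measure (Sol r)}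

omit [IsProbabilityMeasure μ] in
theorem aestronglyMeasurable_weight_coord (S : IsPathSystem r μ m₀ h ν) (n : ℕ) :
    AEStronglyMeasurable[coordFiltration S.cover.measurable n]
      (fun x => ‖m₀ (θ r 0 x)‖ ^ 2) ν := by
  have hm := S.pair.memLp.1
  have h0 : Measurable[coordFiltration S.cover.measurable n] (θ r 0) :=
    (measurable_coordFiltration S.cover.measurable 0).mono
      ((coordFiltration S.cover.measurable).mono (Nat.zero_le n)) le_rfl
  refine ⟨fun x => ‖hm.mk m₀ (θ r 0 x)‖ ^ 2,
    ((hm.stronglyMeasurable_mk.comp_measurable h0).norm.pow 2), ?_⟩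
  filter_upwards [(S.quasiMeasurePreserving_θ 0).ae hm.ae_eq_mk] with x hx
  rw [hx]

/-- Transported by `r̂`, an integral over `{θ_{n+1} ∈ B}` becomes one over `{θ_n ∈ B}` weighted by
`|m₀ ∘ θ₀|²`. Since `θ₀` is a function of `θ_n`, the weight is measurable for the conditioning
σ-algebra and can be pulled out. -/
theorem condExp_shift (S : IsPathSystem r μ m₀ h ν) (n : ℕ) {F : Sol r → ℂ} {φ : X → ℂ} {C : ℝ}
    (hF : AEStronglyMeasurable F ν) (hFC : ∀ᵐ x ∂ν, ‖F x‖ ≤ C) (hφ : Measurable φ)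
    (hcond : ν[F | coordFiltration S.cover.measurable n] =ᵐ[ν] fun x => φ (θ r n x)) :
    ν[fun x => F (shift r x) | coordFiltration S.cover.measurable (n + 1)] =ᵐ[ν]
      fun x => φ (θ r (n + 1) x) := by
  have := S.isFiniteMeasure
  have hq := S.quasiMeasurePreserving_shift
  have hFi : Integrable F ν := .of_bound hF C hFC
  have hFsm : AEStronglyMeasurable (fun x => F (shift r x)) ν := hF.comp_quasiMeasurePreserving hq
  have hφC : ∀ᵐ x ∂ν, ‖φ (θ r n x)‖ ≤ C := by
    filter_upwards [hcond, ae_bdd_norm_condExp_of_ae_bdd_norm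
      (m := coordFiltration S.cover.measurable n) hFC] with x hx hx'
    rwa [hx] at hx'
  have hφm : ∀ k, AEStronglyMeasurable (fun x => φ (θ r k x)) ν := fun k =>
    (hφ.comp (measurable_θ r k)).aestronglyMeasurable
  have hφi : Integrable (fun x => φ (θ r (n + 1) x)) ν := .of_bound (hφm _) C (hq.ae hφC)
  have hWF : Integrable ((fun x => ‖m₀ (θ r 0 x)‖ ^ 2) • F) ν := S.integrable_weight.smul_bdd C hF hFC
  refine (ae_eq_condExp_of_forall_setIntegral_eq ((coordFiltration S.cover.measurable).le _)
    (.of_bound hFsm C (hq.ae hFC)) (fun _ _ _ => hφi.integrableOn) ?_ ?_).symm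
  · rintro _ ⟨B, hB, rfl⟩ -
    have hs : MeasurableSet (θ r (n + 1) ⁻¹' B) := measurable_θ r _ hB
    have hs' : MeasurableSet[coordFiltration S.cover.measurable n] (θ r n ⁻¹' B) := ⟨B, hB, rfl⟩
    rw [S.setIntegral_rhat hs (hφm _), S.setIntegral_rhat hs hFsm]
    change ∫ x in θ r n ⁻¹' B, ‖m₀ (θ r 0 x)‖ ^ 2 • φ (θ r n x) ∂ν =
      ∫ x in θ r n ⁻¹' B, ‖m₀ (θ r 0 x)‖ ^ 2 • F (shift r (rhat r x)) ∂ν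
    simp only [shift_rhat]
    have e1 := condExp_smul_of_aestronglyMeasurable_left
      (S.aestronglyMeasurable_weight_coord n) hWF hFi
    have e2 := setIntegral_condExp ((coordFiltration S.cover.measurable).le n) hWF hs'
    rw [← (show _ = ∫ x in θ r n ⁻¹' B, ‖m₀ (θ r 0 x)‖ ^ 2 • F x ∂ν from e2)]
    refine setIntegral_congr_ae (measurable_θ r n hB) ?_
    filter_upwards [e1, hcond] with x hx hx' _
    rw [hx, Pi.smul_apply', hx']
  · exact (hφ.comp (measurable_coordFiltration S.cover.measurable (n + 1))
      |>.stronglyMeasurable).aestronglyMeasurable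

end IsPathSystem

end Solenoid

/-! ### Convergence of complex martingales. -/

namespace Solenoid

theorem tendsto_ae_condExp_complex {Ω : Type*} {m0 : MeasurableSpace Ω} {κ : Measure Ω}
    [IsFiniteMeasure κ] (ℱ : Filtration ℕ m0) {f : Ω → ℂ} (hf : Integrable f κ) :
    ∀ᵐ x ∂κ, Tendsto (fun n => (κ[f | ℱ n]) x) atTop (𝓝 ((κ[f | ⨆ n, ℱ n]) x)) := by
  have hre : ∀ m : MeasurableSpace Ω, ∀ᵐ x ∂κ, ((κ[f | m]) x).re = (κ[fun x => (f x).re | m]) x :=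
    fun m => Complex.reCLM.comp_condExp_comm hf
  have him : ∀ m : MeasurableSpace Ω, ∀ᵐ x ∂κ, ((κ[f | m]) x).im = (κ[fun x => (f x).im | m]) x :=
    fun m => Complex.imCLM.comp_condExp_comm hf
  filter_upwards [tendsto_ae_condExp (ℱ := ℱ) (μ := κ) fun x => (f x).re,
    tendsto_ae_condExp (ℱ := ℱ) (μ := κ) fun x => (f x).im,
    ae_all_iff.2 fun n => hre (ℱ n), ae_all_iff.2 fun n => him (ℱ n), hre (⨆ n, ℱ n),
    him (⨆ n, ℱ n)] with x h1 h2 h3 h4 h5 h6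
  simp only [← h3, ← h4, ← h5, ← h6] at h1 h2
  have := (Complex.continuous_ofReal.tendsto _).comp h1 |>.add
    (((Complex.continuous_ofReal.tendsto _).comp h2).mul_const Complex.I)
  simpa [Function.comp_def, Complex.re_add_im] using this

/-- A uniformly bounded complex martingale converges almost everywhere. -/
theorem exists_tendsto_of_bounded_martingale {Ω : Type*} {m0 : MeasurableSpace Ω} {κ : Measure Ω}
    [IsFiniteMeasure κ] {ℱ : Filtration ℕ m0} {M : ℕ → Ω → ℂ} (hM : Martingale M ℱ κ) {C : ℝ}
    (hC : ∀ n x, ‖M n x‖ ≤ C) : ∀ᵐ x ∂κ, ∃ l, Tendsto (fun n => M n x) atTop (𝓝 l) := by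
  have key : ∀ L : ℂ →L[ℝ] ℝ, (∀ z, |L z| ≤ ‖z‖) →
      ∀ᵐ x ∂κ, ∃ l, Tendsto (fun n => L (M n x)) atTop (𝓝 l) := fun L hL => by
    have hmart : Martingale (fun n x => L (M n x)) ℱ κ := by
      refine ⟨fun n => L.continuous.comp_stronglyMeasurable (hM.1 n), fun i j hij => ?_⟩
      refine (L.comp_condExp_comm (hM.integrable j)).symm.trans ?_
      filter_upwards [hM.2 i j hij] with x hx
      simp only [Function.comp_apply, hx]
    have hb : ∀ n, eLpNorm (fun x => L (M n x)) 1 κ ≤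
        (κ Set.univ * ENNReal.ofReal C).toNNReal := fun n => by
      rw [ENNReal.coe_toNNReal (ENNReal.mul_ne_top (measure_ne_top _ _) ENNReal.ofReal_ne_top)]
      refine (eLpNorm_le_of_ae_bound (C := C)
        (Eventually.of_forall fun x => (hL _).trans (hC n x))).trans ?_
      simp
    filter_upwards [hmart.submartingale.ae_tendsto_limitProcess hb] with x hx
    exact ⟨_, hx⟩
  filter_upwards [key Complex.reCLM Complex.abs_re_le_norm, key Complex.imCLM
    Complex.abs_im_le_norm] with x ⟨a, ha⟩ ⟨b, hb⟩
  refine ⟨a + b * Complex.I, ?_⟩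
  have := (Complex.continuous_ofReal.tendsto _).comp ha |>.add
    (((Complex.continuous_ofReal.tendsto _).comp hb).mul_const Complex.I)
  simpa [Function.comp_def, Complex.re_add_im] using this

/-! ### Harmonic functions and cocycles. -/

namespace IsPathSystem

variable {X : Type*} [MeasurableSpace X] {r : X → X} {μ : Measure X} [IsProbabilityMeasure μ]
  {m₀ : X → ℂ} {h : X → ℝ} {ν : Measure (Sol r)}

/-- A cocycle is unchanged by the shift, so the identity defining `E₀` propagates from each
coordinate to the next. -/
theorem condExp_cocycle (S : IsPathSystem r μ m₀ h ν) {f : Sol r → ℂ} (hf : IsCocycle r ν f)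
    (n : ℕ) : ν[f | coordFiltration S.cover.measurable n] =ᵐ[ν] fun x => E₀ r ν f (θ r n x) := by
  induction n with
  | zero => exact (E₀_spec r ν f).2.eventuallyEq
  | succ n ih =>
    obtain ⟨C, hC⟩ := hf.bdd.2
    have hs : (fun x => f (shift r x)) =ᵐ[ν] f := by
      filter_upwards [S.quasiMeasurePreserving_shift.ae hf.invariant] with x hx
      rw [hx, rhat_shift]
    exact (condExp_congr_ae hs).symm.trans (S.condExp_shift n hf.bdd.1.aestronglyMeasurable
      (Eventually.of_forall hC) (E₀_spec r ν f).1 ih)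

theorem tendsto_cocycle (S : IsPathSystem r μ m₀ h ν) {f : Sol r → ℂ} (hf : IsCocycle r ν f) :
    ∀ᵐ x ∂ν, Tendsto (fun n => E₀ r ν f (θ r n x)) atTop (𝓝 (f x)) := by
  have := S.isFiniteMeasure
  obtain ⟨C, hC⟩ := hf.bdd.2
  have hi : Integrable f ν :=
    .of_bound hf.bdd.1.aestronglyMeasurable C (Eventually.of_forall hC)
  have h1 := tendsto_ae_condExp_complex (coordFiltration S.cover.measurable) hi
  rw [iSup_coordFiltration, condExp_of_stronglyMeasurable le_rfl hf.bdd.1.stronglyMeasurable hi]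
    at h1
  filter_upwards [h1, ae_all_iff.2 (S.condExp_cocycle hf)] with x hx hx'
  simpa only [hx'] using hx

theorem E₀_bound (S : IsPathSystem r μ m₀ h ν) {f : Sol r → ℂ} {C : ℝ} (hC : ∀ x, ‖f x‖ ≤ C) :
    ∀ᵐ x ∂μ, 0 < h x → ‖E₀ r ν f x‖ ≤ C := by
  refine S.ae_of_ae_θ_zero (measurableSet_le (E₀_spec r ν f).1.norm measurable_const) ?_
  have := ae_bdd_norm_condExp_of_ae_bdd_norm (μ := ν)
    (m := MeasurableSpace.comap (θ r 0) inferInstance) (Eventually.of_forall hC)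
  rw [(E₀_spec r ν f).2] at this
  exact this

theorem integral_θ (S : IsPathSystem r μ m₀ h ν) (n : ℕ) {G : X → ℂ} (hG : Measurable G) :
    ∫ x, G (θ r n x) ∂ν = ∫ x, ((iterWeight r m₀ n x).toReal * max (h x) 0) • G x ∂μ := by
  rw [← integral_map (measurable_θ r n).aemeasurable hG.aestronglyMeasurable, S.map_θ, marginal,
    integral_withDensity_eq_integral_toReal_smul₀ (S.pair.aemeasurable_density S.cover n)]
  · simp [ENNReal.toReal_ofReal']
  · refine Eventually.of_forall fun x => ENNReal.mul_lt_top ?_ ENNReal.ofReal_lt_top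
    exact ENNReal.prod_lt_top fun k _ => by simp

omit [IsProbabilityMeasure μ] in
theorem integrable_mul_h (S : IsPathSystem r μ m₀ h ν) {e : X → ℂ} (he : Measurable e) {C : ℝ}
    (hC : ∀ᵐ x ∂μ, 0 < h x → ‖e x‖ ≤ C) : Integrable (fun x => e x * h x) μ := by
  refine (S.pair.integrable.const_mul C).mono
    (he.aestronglyMeasurable.mul S.pair.integrable.ofReal.1) ?_
  filter_upwards [hC, S.pair.nonneg] with x hx (h0 : 0 ≤ h x)
  rcases h0.eq_or_lt with h0 | h0
  · simp [← h0]
  · rw [norm_mul, norm_mul, Complex.norm_real]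
    gcongr
    exact (hx h0).trans (le_abs_self C)

omit [IsProbabilityMeasure μ] in
theorem integrable_weight_mul (S : IsPathSystem r μ m₀ h ν) {F : X → ℂ} (hF : Integrable F μ) :
    Integrable (fun x => ((‖m₀ x‖ ^ 2 : ℝ) : ℂ) * F x) μ := by
  have h1 : MemLp (fun x => ((‖m₀ x‖ ^ 2 : ℝ) : ℂ)) ∞ μ := by
    have := (S.pair.memLp.norm.mul (r := ∞) S.pair.memLp.norm).ofReal (K := ℂ)
    refine this.ae_eq (Eventually.of_forall fun x => ?_)
    simp [sq]
  exact hF.mul_of_top_right h1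

theorem setIntegral_mul_h (S : IsPathSystem r μ m₀ h ν) {e : X → ℂ} (he : Measurable e)
    {B : Set X} (hB : MeasurableSet B) :
    ∫ x in B, e x * h x ∂μ = ∫ x in θ r 0 ⁻¹' B, e (θ r 0 x) ∂ν := by
  rw [← integral_indicator hB, ← integral_indicator (measurable_θ r 0 hB)]
  have := S.integral_θ 0 (he.indicator hB)
  refine Eq.trans ?_ (this.symm.trans rfl)
  refine integral_congr_ae ?_
  filter_upwards [S.pair.nonneg] with x (h0 : 0 ≤ h x)
  by_cases hx : x ∈ B <;> simp [hx, iterWeight_zero, h0, mul_comm]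

/-- Bridge from `R` to path space: the average of `|m₀|² e h` integrates over `B` to the same value
as `|m₀|² e h` over `r⁻¹ B`, and `|m₀|² h` is the density of the law of `θ₁`. -/
theorem setIntegral_transfer_mul_h (S : IsPathSystem r μ m₀ h ν) {e : X → ℂ} (he : Measurable e)
    {C : ℝ} (hC : ∀ᵐ x ∂μ, 0 < h x → ‖e x‖ ≤ C) {B : Set X} (hB : MeasurableSet B) :
    Integrable (transfer r m₀ fun x => e x * h x) μ ∧
    ∫ x in B, transfer r m₀ (fun x => e x * h x) x ∂μ =
      ∫ x in θ r 0 ⁻¹' B, e (θ r 1 x) ∂ν := by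
  have hi := S.integrable_weight_mul (S.integrable_mul_h he hC)
  have hrB := S.cover.measurable hB
  refine ⟨?_, ?_⟩
  · rw [transfer_eq]
    exact (S.cover.integral_ruelle hi).1
  have hpre : θ r 0 ⁻¹' B = θ r 1 ⁻¹' (r ⁻¹' B) := by
    ext x
    simp only [Set.mem_preimage, θ_succ (r := r) 0 x]
  rw [← integral_indicator hB, hpre, ← integral_indicator (measurable_θ r 1 hrB)]
  have h1 := S.integral_θ 1 (he.indicator hrB)
  refine Eq.trans ?_ (h1.symm.trans rfl)
  have h2 := (S.cover.integral_ruelle (hi.indicator hrB)).2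
  refine Eq.trans (integral_congr_ae (Eventually.of_forall fun x => ?_)) (h2.trans ?_)
  · have h3 := ruelle_comp_mul S.cover.finite_fibre 1 (B.indicator 1)
      (fun y => ((‖m₀ y‖ ^ 2 : ℝ) : ℂ) * (e y * h y)) x
    have h4 : (r ⁻¹' B).indicator (fun y => ((‖m₀ y‖ ^ 2 : ℝ) : ℂ) * (e y * h y)) =
        fun y => B.indicator 1 (r y) * (((‖m₀ y‖ ^ 2 : ℝ) : ℂ) * (e y * h y)) := by
      funext y
      by_cases hy : r y ∈ B <;> simp [Set.indicator, hy]
    simp only [h4, h3, transfer_eq]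
    by_cases hx : x ∈ B <;> simp [hx]
  · refine integral_congr_ae ?_
    filter_upwards [S.pair.nonneg] with x (h0 : 0 ≤ h x)
    by_cases hx : x ∈ r ⁻¹' B
    · simp [hx, iterWeight, h0]
      ring
    · simp [hx]

theorem integrable_comp_θ (S : IsPathSystem r μ m₀ h ν) (n : ℕ) {e : X → ℂ} (he : Measurable e)
    {C : ℝ} (hC : ∀ᵐ x ∂μ, 0 < h x → ‖e x‖ ≤ C) : Integrable (fun x => e (θ r n x)) ν := by
  have := S.isFiniteMeasure
  exact .of_bound (he.comp (measurable_θ r n)).aestronglyMeasurable C (S.ae_θ n hC)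

/-- Both sides say that the integrals of `e ∘ θ₁` and `e ∘ θ₀` agree over every set `{θ₀ ∈ B}`. -/
theorem harmonic_iff (S : IsPathSystem r μ m₀ h ν) {e : X → ℂ} (he : Measurable e) {C : ℝ}
    (hC : ∀ᵐ x ∂μ, 0 < h x → ‖e x‖ ≤ C) :
    transfer r m₀ (fun x => e x * h x) =ᵐ[μ] (fun x => e x * h x) ↔
      ν[fun x => e (θ r 1 x) | coordFiltration S.cover.measurable 0] =ᵐ[ν]
        fun x => e (θ r 0 x) := by
  have := S.isFiniteMeasure
  constructor
  · intro hh
    refine (ae_eq_condExp_of_forall_setIntegral_eq ((coordFiltration S.cover.measurable).le 0)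
      (S.integrable_comp_θ 1 he hC) (fun _ _ _ => (S.integrable_comp_θ 0 he hC).integrableOn)
      ?_ ?_).symm
    · rintro _ ⟨B, hB, rfl⟩ -
      rw [← S.setIntegral_mul_h he hB, ← (S.setIntegral_transfer_mul_h he hC hB).2]
      exact setIntegral_congr_ae hB (hh.mono fun x hx _ => hx.symm)
    · exact (he.comp (measurable_coordFiltration S.cover.measurable 0)
        |>.stronglyMeasurable).aestronglyMeasurable
  · intro hh
    refine Integrable.ae_eq_of_forall_setIntegral_eq _ _
      (S.setIntegral_transfer_mul_h he hC .univ).1 (S.integrable_mul_h he hC) fun B hB _ => ?_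
    rw [S.setIntegral_mul_h he hB, (S.setIntegral_transfer_mul_h he hC hB).2,
      ← setIntegral_condExp ((coordFiltration S.cover.measurable).le 0)
        (S.integrable_comp_θ 1 he hC) ⟨B, hB, rfl⟩]
    exact setIntegral_congr_ae (measurable_θ r 0 hB) (hh.mono fun x hx _ => hx)

theorem isDominatedHarmonic_E₀ (S : IsPathSystem r μ m₀ h ν) {f : Sol r → ℂ}
    (hf : IsCocycle r ν f) :
    IsDominatedHarmonic r μ m₀ h fun x => E₀ r ν f x * h x := by
  have := S.isFiniteMeasure
  obtain ⟨C, hC⟩ := hf.bdd.2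
  have he := (E₀_spec r ν f).1
  have hb := S.E₀_bound hC
  refine ⟨(S.integrable_mul_h he hb).1, (S.harmonic_iff he hb).2 ?_, C ^ 2, sq_nonneg C, ?_⟩
  -- Tower property: `E₀(f) ∘ θ₁` is `E(f | θ₁)`, and conditioning it on `θ₀` gives `E₀(f) ∘ θ₀`.
  · have hm := (coordFiltration S.cover.measurable).mono (Nat.zero_le 1)
    exact ((condExp_congr_ae (S.condExp_cocycle hf 1)).symm.trans (condExp_condExp_of_le hm
      ((coordFiltration S.cover.measurable).le 1))).trans (S.condExp_cocycle hf 0)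
  · filter_upwards [hb, S.pair.nonneg] with x hx (h0 : 0 ≤ h x)
    rcases h0.eq_or_lt with h0 | h0
    · simp [← h0]
    · rw [norm_mul, Complex.norm_real, mul_pow, Real.norm_eq_abs, sq_abs]
      gcongr
      exact hx h0

omit [IsProbabilityMeasure μ] in
theorem exists_measurable_quotient (S : IsPathSystem r μ m₀ h ν) {h₀ : X → ℂ}
    (hh : IsDominatedHarmonic r μ m₀ h h₀) :
    ∃ (e : X → ℂ) (C : ℝ), Measurable e ∧ (∀ x, ‖e x‖ ≤ C) ∧ h₀ =ᵐ[μ] fun x => e x * h x := by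
  obtain ⟨c, hc, hdom⟩ := hh.dominated
  have hq : AEMeasurable (fun x => h₀ x / (h x : ℂ)) μ :=
    hh.aestronglyMeasurable.aemeasurable.div S.pair.integrable.ofReal.1.aemeasurable
  -- Truncating at `√c` changes the quotient only where `h` vanishes or on a null set, and gives a
  -- bound valid everywhere.
  refine ⟨{x | ‖hq.mk _ x‖ ≤ √c}.indicator (hq.mk _), √c, hq.measurable_mk.indicator
    (measurableSet_le hq.measurable_mk.norm measurable_const), fun x => ?_, ?_⟩
  · by_cases hx : ‖hq.mk _ x‖ ≤ √c
    · rwa [Set.indicator_of_mem (by exact hx)]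
    · rw [Set.indicator_of_notMem (by exact hx), norm_zero]
      positivity
  · filter_upwards [hdom, hq.ae_eq_mk, S.pair.nonneg] with x hx hx' (h0 : 0 ≤ h x)
    rcases h0.eq_or_lt with h0 | h0
    -- Where `h = 0`, domination forces `h₀ = 0`.
    · simpa [← h0] using hx
    · have hne : (h x : ℂ) ≠ 0 := by exact_mod_cast h0.ne'
      have : ‖hq.mk _ x‖ ≤ √c := by
        rw [← hx', norm_div, Complex.norm_real, Real.norm_of_nonneg h0.le, div_le_iff₀ h0]
        refine le_of_sq_le_sq ?_ (by positivity)
        rwa [mul_pow, Real.sq_sqrt hc]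
      rw [Set.indicator_of_mem (by exact this), ← hx', div_mul_cancel₀ _ hne]

theorem condExp_comp_θ_succ (S : IsPathSystem r μ m₀ h ν) {e : X → ℂ} (he : Measurable e) {C : ℝ}
    (hC : ∀ x, ‖e x‖ ≤ C) (hharm : transfer r m₀ (fun x => e x * h x) =ᵐ[μ] fun x => e x * h x)
    (n : ℕ) : ν[fun x => e (θ r (n + 1) x) | coordFiltration S.cover.measurable n] =ᵐ[ν]
      fun x => e (θ r n x) := by
  induction n with
  | zero => exact (S.harmonic_iff he (Eventually.of_forall fun x _ => hC x)).1 hharm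
  | succ n ih =>
    exact S.condExp_shift n (F := fun x => e (θ r (n + 1) x))
      (he.comp (measurable_θ r _)).aestronglyMeasurable (Eventually.of_forall fun x => hC _) he ih

/-- With `h₀ = e h`, the functions `e ∘ θ_n` form a bounded martingale; its limit is the cocycle. -/
theorem exists_cocycle (S : IsPathSystem r μ m₀ h ν) {h₀ : X → ℂ}
    (hh : IsDominatedHarmonic r μ m₀ h h₀) :
    ∃ f : Sol r → ℂ, IsCocycle r ν f ∧ h₀ =ᵐ[μ] fun x => E₀ r ν f x * h x := by
  have := S.isFiniteMeasure
  obtain ⟨e, C, he, hC, heq⟩ := S.exists_measurable_quotient hh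
  have hC' : ∀ᵐ x ∂μ, 0 < h x → ‖e x‖ ≤ C := Eventually.of_forall fun x _ => hC x
  have hharm : transfer r m₀ (fun x => e x * h x) =ᵐ[μ] fun x => e x * h x :=
    (S.cover.ruelle_congr_ae heq).symm.trans (hh.harmonic.trans heq)
  have hmart : Martingale (fun n x => e (θ r n x)) (coordFiltration S.cover.measurable) ν :=
    martingale_nat (fun n => (he.comp (measurable_coordFiltration S.cover.measurable n)
      |>.stronglyMeasurable)) (fun n => S.integrable_comp_θ n he hC') fun n =>
      (S.condExp_comp_θ_succ he hC hharm n).symm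
  obtain ⟨F, hF, hlim⟩ := measurable_limit_of_tendsto_metrizable_ae
    (fun n => (he.comp (measurable_θ r n)).aemeasurable)
    (exists_tendsto_of_bounded_martingale hmart fun n x => hC _)
  have hFC : ∀ᵐ x ∂ν, ‖F x‖ ≤ C := by
    filter_upwards [hlim] with x hx
    exact le_of_tendsto hx.norm (Eventually.of_forall fun n => hC _)
  -- The limit is bounded by `C` only almost everywhere, while cocycles are bounded at every point.
  let f : Sol r → ℂ := {x | ‖F x‖ ≤ C}.indicator F
  have hfF : f =ᵐ[ν] F := by
    filter_upwards [hFC] with x hx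
    exact Set.indicator_of_mem (by exact hx) _
  have hflim : ∀ᵐ x ∂ν, Tendsto (fun n => e (θ r n x)) atTop (𝓝 (f x)) := by
    filter_upwards [hlim, hfF] with x hx hx'
    rwa [hx']
  have hfb : IsBddMeas f := by
    refine ⟨hF.indicator (measurableSet_le hF.norm measurable_const), C, fun x => ?_⟩
    by_cases hx : ‖F x‖ ≤ C
    · simpa only [f, Set.indicator_of_mem (show x ∈ {x | ‖F x‖ ≤ C} from hx)]
    · simpa only [f, Set.indicator_of_notMem (show x ∉ {x | ‖F x‖ ≤ C} from hx), norm_zero]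
        using (norm_nonneg _).trans (hC (θ r 0 x))
  have hcoc : IsCocycle r ν f := by
    refine ⟨hfb, ?_⟩
    filter_upwards [hflim, S.quasiMeasurePreserving_rhat.ae hflim] with x hx hx'
    -- Composing with `r̂` only shifts the index of the sequence, so the limit is invariant.
    exact tendsto_nhds_unique hx ((tendsto_add_atTop_iff_nat 1).2 hx')
  refine ⟨f, hcoc, heq.trans ?_⟩
  have hE : ν[f | coordFiltration S.cover.measurable 0] =ᵐ[ν] fun x => e (θ r 0 x) := by
    refine (ae_eq_condExp_of_forall_setIntegral_eq ((coordFiltration S.cover.measurable).le 0)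
      (.of_bound hfb.1.aestronglyMeasurable C (hFC.congr (hfF.mono fun x hx => by simp only [hx])))
      (fun _ _ _ => (S.integrable_comp_θ 0 he hC').integrableOn) ?_
      (hmart.1 0).aestronglyMeasurable).symm
    intro s hs _
    -- The integrals over `s` are constant in `n` by the martingale property, so their limit
    -- identifies `E₀(f)` with `e`.
    have ht : Tendsto (fun n => ∫ x in s, e (θ r n x) ∂ν) atTop (𝓝 (∫ x in s, f x ∂ν)) :=
      tendsto_integral_of_dominated_convergence (fun _ => C)
        (fun n => (he.comp (measurable_θ r n)).aestronglyMeasurable) (integrable_const C)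
        (fun n => Eventually.of_forall fun x => hC _) (ae_restrict_of_ae hflim)
    refine tendsto_nhds_unique (tendsto_const_nhds.congr fun n => ?_) ht
    exact hmart.setIntegral_eq (Nat.zero_le n) hs
  have hE' : ∀ᵐ x ∂ν, e (θ r 0 x) = E₀ r ν f (θ r 0 x) :=
    hE.symm.trans (S.condExp_cocycle hcoc 0)
  filter_upwards [S.ae_of_ae_θ_zero (p := fun x => e x = E₀ r ν f x)
    (measurableSet_eq_fun he (E₀_spec r ν f).1) hE', S.pair.nonneg] with x hx (h0 : 0 ≤ h x)
  rcases h0.eq_or_lt with h0 | h0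
  · simp [← h0]
  · rw [hx h0]

theorem div_eq_E₀ (S : IsPathSystem r μ m₀ h ν) {h₀ : X → ℂ} {f : Sol r → ℂ}
    (heq : h₀ =ᵐ[μ] fun x => E₀ r ν f x * h x) (n : ℕ) :
    ∀ᵐ x ∂ν, h₀ (θ r n x) / (h (θ r n x) : ℂ) = E₀ r ν f (θ r n x) := by
  refine S.ae_θ n (p := fun x => h₀ x / (h x : ℂ) = E₀ r ν f x) ?_
  filter_upwards [heq] with x hx h0
  have hne : (h x : ℂ) ≠ 0 := by exact_mod_cast h0.ne'
  rw [hx, mul_div_cancel_right₀ _ hne]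

theorem tendsto_div (S : IsPathSystem r μ m₀ h ν) {h₀ : X → ℂ} {f : Sol r → ℂ}
    (hf : IsCocycle r ν f) (heq : h₀ =ᵐ[μ] fun x => E₀ r ν f x * h x) :
    ∀ᵐ x ∂ν, Tendsto (fun n => h₀ (θ r n x) / (h (θ r n x) : ℂ)) atTop (𝓝 (f x)) := by
  filter_upwards [S.tendsto_cocycle hf, ae_all_iff.2 (S.div_eq_E₀ heq)] with x hx hx'
  simpa only [hx'] using hx

/-- The limit formula recovers a cocycle from `h₀` and `h` alone. -/
theorem cocycle_unique (S : IsPathSystem r μ m₀ h ν) {h₀ : X → ℂ} {f f' : Sol r → ℂ}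
    (hf : IsCocycle r ν f) (heq : h₀ =ᵐ[μ] fun x => E₀ r ν f x * h x)
    (hf' : IsCocycle r ν f') (heq' : h₀ =ᵐ[μ] fun x => E₀ r ν f' x * h x) : f' =ᵐ[ν] f := by
  filter_upwards [S.tendsto_div hf heq, S.tendsto_div hf' heq'] with x hx hx'
  exact tendsto_nhds_unique hx' hx

theorem memLp_div (S : IsPathSystem r μ m₀ h ν) {h₀ : X → ℂ} {f : Sol r → ℂ}
    (hf : IsCocycle r ν f) (heq : h₀ =ᵐ[μ] fun x => E₀ r ν f x * h x) (p : ℝ≥0∞) (n : ℕ) :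
    MemLp (fun x => h₀ (θ r n x) / (h (θ r n x) : ℂ)) p ν := by
  have := S.isFiniteMeasure
  obtain ⟨C, hC⟩ := hf.bdd.2
  refine MemLp.ae_eq (EventuallyEq.symm (S.div_eq_E₀ heq n)) ?_
  exact .of_bound ((E₀_spec r ν f).1.comp (measurable_θ r n)).aestronglyMeasurable C
    (S.ae_θ n (S.E₀_bound hC))

theorem tendsto_eLpNorm_div (S : IsPathSystem r μ m₀ h ν) {h₀ : X → ℂ} {f : Sol r → ℂ}
    (hf : IsCocycle r ν f) (heq : h₀ =ᵐ[μ] fun x => E₀ r ν f x * h x) {p : ℝ≥0∞} (hp : 1 ≤ p)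
    (hp' : p ≠ ∞) :
    Tendsto (fun n : ℕ => eLpNorm (fun x => h₀ (θ r n x) / (h (θ r n x) : ℂ) - f x) p ν)
      atTop (𝓝 0) := by
  have := S.isFiniteMeasure
  obtain ⟨C, hC⟩ := hf.bdd.2
  have hp0 : p ≠ 0 := (zero_lt_one.trans_le hp).ne'
  have hpr : 0 < p.toReal := ENNReal.toReal_pos hp0 hp'
  have hm : ∀ n, AEStronglyMeasurable (fun x => h₀ (θ r n x) / (h (θ r n x) : ℂ) - f x) ν :=
    fun n => (S.memLp_div hf heq p n).1.sub hf.bdd.1.aestronglyMeasurable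
  have hl : Tendsto (fun n => ∫⁻ x, ‖h₀ (θ r n x) / (h (θ r n x) : ℂ) - f x‖ₑ ^ p.toReal ∂ν)
      atTop (𝓝 (∫⁻ _, 0 ∂ν)) := by
    -- Both the quotient and `f` are bounded by `C`, and the measure is finite.
    refine tendsto_lintegral_of_dominated_convergence' (fun _ => ENNReal.ofReal (C + C) ^ p.toReal)
      (fun n => (hm n).enorm.pow_const _) (fun n => ?_) ?_ ?_
    · filter_upwards [S.div_eq_E₀ heq n, S.ae_θ n (S.E₀_bound hC)] with x hx hx'
      gcongr
      rw [← ofReal_norm, hx]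
      exact ENNReal.ofReal_le_ofReal ((norm_sub_le _ _).trans (add_le_add hx' (hC x)))
    · rw [lintegral_const]
      exact ENNReal.mul_ne_top (ENNReal.rpow_ne_top_of_nonneg hpr.le ENNReal.ofReal_ne_top)
        (measure_ne_top _ _)
    · filter_upwards [S.tendsto_div hf heq] with x hx
      have h1 : Tendsto (fun n => ‖h₀ (θ r n x) / (h (θ r n x) : ℂ) - f x‖ₑ) atTop (𝓝 0) := by
        have := (hx.sub_const (f x)).enorm
        simpa using this
      have := (ENNReal.continuous_rpow_const (y := p.toReal)).tendsto 0 |>.comp h1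
      simpa [ENNReal.zero_rpow_of_pos hpr, Function.comp_def] using this
  simp only [eLpNorm_eq_lintegral_rpow_enorm_toReal hp0 hp']
  have := (ENNReal.continuous_rpow_const (y := 1 / p.toReal)).tendsto _ |>.comp hl
  simpa [ENNReal.zero_rpow_of_pos (inv_pos.2 hpr), Function.comp_def] using this

end IsPathSystem

end Solenoid

namespace Solenoid

/-! ### Operators commuting with a generating ring of indicators. -/

section Multiplication

variable {Ω : Type*} [mΩ : MeasurableSpace Ω] {κ : Measure Ω}

theorem IsBddMeas.indicator {f : Ω → ℂ} (hf : Measurable f) {s : Set Ω} (hs : MeasurableSet s)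
    {C : ℝ} (hC : ∀ x ∈ s, ‖f x‖ ≤ C) : IsBddMeas (s.indicator f) := by
  refine ⟨hf.indicator hs, max C 0, fun x => ?_⟩
  by_cases hx : x ∈ s
  · rw [Set.indicator_of_mem hx]
    exact (hC x hx).trans (le_max_left _ _)
  · simp [Set.indicator_of_notMem hx]

theorem isBddMeas_indicator_one {s : Set Ω} (hs : MeasurableSet s) :
    IsBddMeas (s.indicator (1 : Ω → ℂ)) :=
  .indicator measurable_one hs (C := 1) fun _ _ => by simp

variable [IsFiniteMeasure κ]

/-- Operators that agree on the indicators of a generating ring of sets are equal. -/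
theorem clm_ext_of_setRing {𝒞 : Set (Set Ω)} (hring : IsSetRing 𝒞) (huniv : Set.univ ∈ 𝒞)
    (hgen : mΩ = MeasurableSpace.generateFrom 𝒞) {S T : Lp ℂ 2 κ →L[ℂ] Lp ℂ 2 κ}
    (hST : ∀ C ∈ 𝒞, ∀ hC : MeasurableSet C, S (indicatorConstLp 2 hC (measure_ne_top κ C) 1) =
      T (indicatorConstLp 2 hC (measure_ne_top κ C) 1)) : S = T := by
  have hall : ∀ s (hs : MeasurableSet s), S (indicatorConstLp 2 hs (measure_ne_top κ s) 1) =
      T (indicatorConstLp 2 hs (measure_ne_top κ s) 1) := fun s hs => by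
    obtain ⟨u, -, hu, hu0⟩ := exists_seq_strictAnti_tendsto' (zero_lt_one' ℝ≥0∞)
    -- Ring elements approximate any measurable set in measure, hence their indicators approximate
    -- its indicator in `L²`.
    choose t ht htu using fun n => exists_measure_symmDiff_lt_of_generateFrom_isSetRing (μ := κ)
      hring ⟨{Set.univ}, Set.countable_singleton _, by simpa using huniv, by simp⟩ hgen hs
      (hu n).1
    have htm : ∀ n, MeasurableSet (t n) := fun n => by
      rw [hgen]
      exact MeasurableSpace.measurableSet_generateFrom (ht n)
    have hlim := tendsto_indicatorConstLp_set (p := 2) (μ := κ) (c := (1 : ℂ)) (hs := hs)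
      (hμs := measure_ne_top κ s) (t := t) (ht := htm) (hμt := fun n => measure_ne_top κ _)
      (l := atTop) (by simp)
      (tendsto_of_tendsto_of_tendsto_of_le_of_le tendsto_const_nhds hu0 (fun _ => zero_le)
        fun n => (htu n).le)
    refine tendsto_nhds_unique ((S.continuous.tendsto _).comp hlim)
      (((T.continuous.tendsto _).comp hlim).congr fun n => ?_)
    exact (hST _ (ht n) (htm n)).symm
  refine ContinuousLinearMap.ext fun v => ?_
  induction v using Lp.induction (ENNReal.ofNat_ne_top (n := 2)) with
  | @indicatorConst c s hs hμs =>
    have : (Lp.simpleFunc.indicatorConst 2 hs hμs.ne c : Lp ℂ 2 κ) =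
        c • indicatorConstLp 2 hs (measure_ne_top κ _) (1 : ℂ) := by
      rw [Lp.simpleFunc.coe_indicatorConst]
      refine Lp.ext ?_
      filter_upwards [indicatorConstLp_coeFn (p := 2) (hs := hs) (hμs := hμs.ne) (c := c),
        Lp.coeFn_smul c (indicatorConstLp 2 hs (measure_ne_top κ _) (1 : ℂ)),
        indicatorConstLp_coeFn (p := 2) (hs := hs) (hμs := measure_ne_top κ _) (c := (1 : ℂ))]
        with x h1 h2 h3
      rw [h1, h2, Pi.smul_apply, h3]
      by_cases hx : x ∈ s <;> simp [hx]
    rw [this, map_smul, map_smul, hall]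
  | add hf hg _ h1 h2 => rw [map_add, map_add, h1, h2]
  | isClosed => exact isClosed_eq S.continuous T.continuous

/-- Testing on the indicator of `s` gives `∫_s |F|² ≤ ‖A‖² κ(s)` for every measurable `s`. -/
theorem norm_le_opNorm_of_ae_eq_mul {A : Lp ℂ 2 κ →L[ℂ] Lp ℂ 2 κ} {F : Ω → ℂ} (hF : Measurable F)
    (hA : ∀ v, A v =ᵐ[κ] fun x => F x * v x) : ∀ᵐ x ∂κ, ‖F x‖ ≤ ‖A‖ := by
  have key : (fun x => ‖F x‖ₑ ^ 2) ≤ᵐ[κ] fun _ => ‖A‖ₑ ^ 2 := by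
    refine ae_le_of_forall_setLIntegral_le_of_sigmaFinite (hF.enorm.pow_const 2) fun s hs _ => ?_
    have e1 : A (indicatorConstLp 2 hs (measure_ne_top κ s) 1) =ᵐ[κ] s.indicator F := by
      filter_upwards [hA (indicatorConstLp 2 hs (measure_ne_top κ s) 1),
        indicatorConstLp_coeFn (p := 2) (hs := hs) (hμs := measure_ne_top κ s) (c := (1 : ℂ))]
        with x h1 h2
      rw [h1, h2]
      by_cases hx : x ∈ s <;> simp [hx]
    have e2 : eLpNorm F 2 (κ.restrict s) ≤ ‖A‖ₑ * κ s ^ (1 / (2 : ℝ)) := by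
      rw [← eLpNorm_indicator_eq_eLpNorm_restrict hs, ← eLpNorm_congr_ae e1, ← Lp.enorm_def]
      refine (A.le_opENorm _).trans ?_
      gcongr
      simpa using enorm_indicatorConstLp_le (p := 2) (hs := hs) (hμs := measure_ne_top κ s)
        (c := (1 : ℂ))
    have e3 := eLpNorm_nnreal_pow_eq_lintegral (f := F) (μ := κ.restrict s) (p := 2) two_ne_zero
    simp only [ENNReal.coe_ofNat, NNReal.coe_ofNat, ENNReal.rpow_ofNat] at e3
    rw [← e3, setLIntegral_const]
    calc _ ≤ (‖A‖ₑ * κ s ^ (1 / (2 : ℝ))) ^ 2 := by gcongr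
      _ = _ := by
        rw [mul_pow, ← ENNReal.rpow_natCast (κ s ^ _), ← ENNReal.rpow_mul]
        simp
  filter_upwards [key] with x hx
  have : ‖F x‖ₑ ≤ ‖A‖ₑ := (ENNReal.pow_le_pow_left_iff two_ne_zero).1 hx
  simpa [← ofReal_norm, ENNReal.ofReal_le_ofReal_iff] using this

/-- With `F = A 1`, commutation gives `A 1_C = 1_C F` on the ring. Density cannot be used at once
because `F` is only known to be in `L²`; after cutting to `{|F| ≤ M}` both sides are bounded
operators, and letting `M` grow recovers `A v = F v`. -/
theorem eq_mulOp_of_commute_setRing {𝒞 : Set (Set Ω)} (hring : IsSetRing 𝒞)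
    (huniv : Set.univ ∈ 𝒞) (hgen : mΩ = MeasurableSpace.generateFrom 𝒞)
    {A : Lp ℂ 2 κ →L[ℂ] Lp ℂ 2 κ}
    (hA : ∀ C ∈ 𝒞, ∀ hC : MeasurableSet C, ∀ v,
      A (mulOp κ (isBddMeas_indicator_one hC) v) = mulOp κ (isBddMeas_indicator_one hC) (A v)) :
    ∃ (f : Ω → ℂ) (hf : IsBddMeas f), A = mulOp κ hf := by
  let one : Lp ℂ 2 κ := indicatorConstLp 2 .univ (measure_ne_top κ _) 1
  have hone : one =ᵐ[κ] fun _ => 1 := by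
    filter_upwards [indicatorConstLp_coeFn (p := 2) (hs := MeasurableSet.univ)
      (hμs := measure_ne_top κ _) (c := (1 : ℂ))] with x hx
    exact hx.trans (by simp)
  let F : Ω → ℂ := A one
  have hF : Measurable F := (Lp.stronglyMeasurable (A one)).measurable
  have hind : ∀ C ∈ 𝒞, ∀ hC : MeasurableSet C,
      A (indicatorConstLp 2 hC (measure_ne_top κ C) 1) =ᵐ[κ] C.indicator F := fun C hCm hC => by
    have e : indicatorConstLp 2 hC (measure_ne_top κ C) (1 : ℂ) =
        mulOp κ (isBddMeas_indicator_one hC) one := by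
      refine Lp.ext ?_
      filter_upwards [mulOp_coeFn κ (isBddMeas_indicator_one hC) one, hone,
        indicatorConstLp_coeFn (p := 2) (hs := hC) (hμs := measure_ne_top κ C) (c := (1 : ℂ))]
        with x h1 h2 h3
      rw [h1, h2, h3, mul_one]
      rfl
    rw [e, hA C hCm hC]
    filter_upwards [mulOp_coeFn κ (isBddMeas_indicator_one hC) (A one)] with x h1
    rw [h1]
    by_cases hx : x ∈ C <;> simp [hx, F]
  have hD : ∀ M : ℕ, MeasurableSet {x | ‖F x‖ ≤ M} := fun M =>
    measurableSet_le hF.norm measurable_const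
  have hmul : ∀ M : ℕ, (mulOp κ (isBddMeas_indicator_one (hD M))).comp A =
      mulOp κ (IsBddMeas.indicator hF (hD M) fun _ hx => hx) := fun M => by
    refine clm_ext_of_setRing hring huniv hgen fun C hCm hC => Lp.ext ?_
    filter_upwards [mulOp_coeFn κ (isBddMeas_indicator_one (hD M))
        (A (indicatorConstLp 2 hC (measure_ne_top κ C) 1)),
      mulOp_coeFn κ (IsBddMeas.indicator hF (hD M) fun _ hx => hx)
        (indicatorConstLp 2 hC (measure_ne_top κ C) 1), hind C hCm hC,
      indicatorConstLp_coeFn (p := 2) (hs := hC) (hμs := measure_ne_top κ C) (c := (1 : ℂ))]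
      with x h1 h2 h3 h4
    rw [ContinuousLinearMap.comp_apply, h1, h2, h3, h4]
    by_cases hx : x ∈ C <;> by_cases hx' : ‖F x‖ ≤ M <;> simp [hx, hx']
  have hAF : ∀ v, A v =ᵐ[κ] fun x => F x * v x := fun v => by
    filter_upwards [ae_all_iff.2 fun M => mulOp_coeFn κ (isBddMeas_indicator_one (hD M)) (A v),
      ae_all_iff.2 fun M => mulOp_coeFn κ (IsBddMeas.indicator hF (hD M) fun _ hx => hx) v]
      with x h1 h2
    obtain ⟨M, hM⟩ := exists_nat_ge ‖F x‖
    have h3 := h1 M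
    rw [← ContinuousLinearMap.comp_apply, hmul M, h2 M,
      Set.indicator_of_mem (show x ∈ {x | ‖F x‖ ≤ M} from hM),
      Set.indicator_of_mem (show x ∈ {x | ‖F x‖ ≤ M} from hM), Pi.one_apply, one_mul] at h3
    exact h3.symm
  have hb := norm_le_opNorm_of_ae_eq_mul hF hAF
  refine ⟨_, IsBddMeas.indicator hF (s := {x | ‖F x‖ ≤ ‖A‖})
    (measurableSet_le hF.norm measurable_const) fun _ hx => hx, ?_⟩
  refine ContinuousLinearMap.ext fun v => Lp.ext ?_
  filter_upwards [hAF v, hb, mulOp_coeFn κ (IsBddMeas.indicator hF (s := {x | ‖F x‖ ≤ ‖A‖})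
    (measurableSet_le hF.norm measurable_const) fun _ hx => hx) v] with x h1 h2 h3
  rw [h1, h3, Set.indicator_of_mem (show x ∈ {x | ‖F x‖ ≤ ‖A‖} from h2)]

end Multiplication

/-! ### The unitary `U` and its commutant with `π`. -/

namespace IsPathSystem

variable {X : Type*} [MeasurableSpace X] {r : X → X} {μ : Measure X} [IsProbabilityMeasure μ]
  {m₀ : X → ℂ} {h : X → ℝ} {ν : Measure (Sol r)}

theorem eLpNorm_mul_comp_rhat (S : IsPathSystem r μ m₀ h ν) {v : Sol r → ℂ}
    (hv : AEStronglyMeasurable v ν) :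
    eLpNorm (fun x => m₀ (θ r 0 x) * v (rhat r x)) 2 ν = eLpNorm v 2 ν := by
  have := S.lintegral_rhat (F := fun x => ‖v x‖ₑ ^ 2) (hv.enorm.pow_const 2)
  simp only [eLpNorm_eq_lintegral_rpow_enorm_toReal two_ne_zero ENNReal.ofNat_ne_top,
    ENNReal.toReal_ofNat, ENNReal.rpow_ofNat, ← this, enorm_mul, mul_pow]

theorem memLp_mul_comp_rhat (S : IsPathSystem r μ m₀ h ν) {v : Sol r → ℂ} (hv : MemLp v 2 ν) :
    MemLp (fun x => m₀ (θ r 0 x) * v (rhat r x)) 2 ν :=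
  ⟨S.aestronglyMeasurable_m₀.mul
    (hv.1.comp_quasiMeasurePreserving S.quasiMeasurePreserving_rhat),
    (S.eLpNorm_mul_comp_rhat hv.1).trans_lt hv.2⟩

theorem exists_unitary (S : IsPathSystem r μ m₀ h ν) :
    ∃ U : Lp ℂ 2 ν ≃ₗᵢ[ℂ] Lp ℂ 2 ν,
      ∀ v, U v =ᵐ[ν] fun x => m₀ (θ r 0 x) * v (rhat r x) := by
  have hq := S.quasiMeasurePreserving_rhat
  let T : Lp ℂ 2 ν →ₗᵢ[ℂ] Lp ℂ 2 ν :=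
    { toFun := fun v => (S.memLp_mul_comp_rhat (Lp.memLp v)).toLp _
      map_add' := fun v w => by
        rw [← MemLp.toLp_add]
        refine MemLp.toLp_congr _ _ ?_
        filter_upwards [hq.ae (Lp.coeFn_add v w)] with x hx
        simp only [hx, Pi.add_apply, mul_add]
      map_smul' := fun c v => by
        rw [RingHom.id_apply, ← MemLp.toLp_const_smul]
        refine MemLp.toLp_congr _ _ ?_
        filter_upwards [hq.ae (Lp.coeFn_smul c v)] with x hx
        simp only [hx, Pi.smul_apply, smul_eq_mul, mul_left_comm]
      norm_map' := fun v => by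
        refine (Lp.norm_toLp _ (S.memLp_mul_comp_rhat (Lp.memLp v))).trans ?_
        rw [S.eLpNorm_mul_comp_rhat (Lp.aestronglyMeasurable v), Lp.norm_def] }
  have hT : ∀ v, T v =ᵐ[ν] fun x => m₀ (θ r 0 x) * v (rhat r x) := fun v =>
    (S.memLp_mul_comp_rhat (Lp.memLp v)).coeFn_toLp
  have hsurj : Function.Surjective T := fun w => by
    -- The preimage of `w`, obtained by solving `m₀(θ₀ x) v(r̂ x) = w(x)` along the inverse of `r̂`.
    let v : Sol r → ℂ := fun x => w (shift r x) / m₀ (θ r 0 (shift r x))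
    have hvm : AEStronglyMeasurable v ν :=
      ((Lp.aestronglyMeasurable w).aemeasurable.div S.aestronglyMeasurable_m₀.aemeasurable
        |>.aestronglyMeasurable).comp_quasiMeasurePreserving S.quasiMeasurePreserving_shift
    have hvw : (fun x => m₀ (θ r 0 x) * v (rhat r x)) =ᵐ[ν] w := by
      filter_upwards [S.ae_ne_zero] with x hx
      simp only [v, shift_rhat]
      exact mul_div_cancel₀ _ hx
    have hv : MemLp v 2 ν :=
      ⟨hvm, by rw [← S.eLpNorm_mul_comp_rhat hvm, eLpNorm_congr_ae hvw]; exact Lp.eLpNorm_lt_top w⟩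
    refine ⟨hv.toLp v, Lp.ext ((hT _).trans ?_)⟩
    filter_upwards [hvw, hq.ae hv.coeFn_toLp] with x h1 h2
    rw [h2, h1]
  exact ⟨LinearIsometryEquiv.ofSurjective T hsurj, hT⟩

variable {U : Lp ℂ 2 ν ≃ₗᵢ[ℂ] Lp ℂ 2 ν}

theorem commutes_mulOp (S : IsPathSystem r μ m₀ h ν)
    (hU : ∀ v, U v =ᵐ[ν] fun x => m₀ (θ r 0 x) * v (rhat r x)) {f : Sol r → ℂ}
    (hf : IsCocycle r ν f) : Commutes r ν U (mulOp ν hf.bdd) := by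
  refine ⟨fun v => Lp.ext ?_, fun g hg v => Lp.ext ?_⟩
  · filter_upwards [mulOp_coeFn ν hf.bdd (U v), hU v, hU (mulOp ν hf.bdd v),
      S.quasiMeasurePreserving_rhat.ae (mulOp_coeFn ν hf.bdd v), hf.invariant] with x h1 h2 h3 h4 h5
    rw [h1, h2, h3, h4, ← h5]
    ring
  · have hg' := hg.comp (measurable_θ r 0)
    filter_upwards [mulOp_coeFn ν hf.bdd (rep r ν hg v), mulOp_coeFn ν hg' v,
      mulOp_coeFn ν hg' (mulOp ν hf.bdd v), mulOp_coeFn ν hf.bdd v] with x h1 h2 h3 h4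
    rw [h1, rep, h2, h3, h4]
    ring

/-- Since `θ_{n+1} ∘ r̂ = θ_n`, conjugation by `U` lowers the coordinate index by one, and the
induction ends at `π`. -/
theorem commute_mulOp_θ (S : IsPathSystem r μ m₀ h ν)
    (hU : ∀ v, U v =ᵐ[ν] fun x => m₀ (θ r 0 x) * v (rhat r x))
    {A : Lp ℂ 2 ν →L[ℂ] Lp ℂ 2 ν} (hA : Commutes r ν U A) {g : X → ℂ} (hg : IsBddMeas g) (n : ℕ)
    (v : Lp ℂ 2 ν) : A (mulOp ν (hg.comp (measurable_θ r n)) v) =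
      mulOp ν (hg.comp (measurable_θ r n)) (A v) := by
  induction n generalizing v with
  | zero => exact hA.2 g hg v
  | succ n ih =>
    have e : ∀ w, U (mulOp ν (hg.comp (measurable_θ r (n + 1))) w) =
        mulOp ν (hg.comp (measurable_θ r n)) (U w) := fun w => Lp.ext (by
      filter_upwards [hU (mulOp ν (hg.comp (measurable_θ r (n + 1))) w),
        S.quasiMeasurePreserving_rhat.ae (mulOp_coeFn ν (hg.comp (measurable_θ r (n + 1))) w),
        mulOp_coeFn ν (hg.comp (measurable_θ r n)) (U w), hU w] with x h1 h2 h3 h4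
      rw [h1, h2, h3, h4, θ_rhat_succ]
      ring)
    refine U.injective ?_
    rw [← hA.1, e, ih, e, hA.1]

theorem exists_eq_mulOp (S : IsPathSystem r μ m₀ h ν)
    (hU : ∀ v, U v =ᵐ[ν] fun x => m₀ (θ r 0 x) * v (rhat r x))
    {A : Lp ℂ 2 ν →L[ℂ] Lp ℂ 2 ν} (hA : Commutes r ν U A) :
    ∃ (f : Sol r → ℂ) (hf : IsCocycle r ν f), A = mulOp ν hf.bdd := by
  have := S.isFiniteMeasure
  obtain ⟨f, hf, rfl⟩ := eq_mulOp_of_commute_setRing (κ := ν) (A := A)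
    (isSetRing_cylinders S.cover.measurable) ⟨0, Set.univ, .univ, rfl⟩ generateFrom_cylinders (by
      rintro _ ⟨n, B, hB, rfl⟩ hC v
      exact S.commute_mulOp_θ hU hA (isBddMeas_indicator_one hB) n v)
  refine ⟨f, ⟨hf, ?_⟩, rfl⟩
  let one : Lp ℂ 2 ν := indicatorConstLp 2 .univ (measure_ne_top ν _) 1
  have hone : one =ᵐ[ν] fun _ => 1 := by
    filter_upwards [indicatorConstLp_coeFn (p := 2) (hs := MeasurableSet.univ)
      (hμs := measure_ne_top ν _) (c := (1 : ℂ))] with x hx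
    exact hx.trans (by simp)
  have h0 := hA.1 one
  filter_upwards [mulOp_coeFn ν hf (U one), hU one, hU (mulOp ν hf one),
    S.quasiMeasurePreserving_rhat.ae (mulOp_coeFn ν hf one),
    S.quasiMeasurePreserving_rhat.ae hone, S.ae_ne_zero] with x h1 h2 h3 h4 h5 h6
  -- Evaluating the commutation with `U` at the constant `1` yields `f · m₀(θ₀) = m₀(θ₀) · (f ∘
  -- r̂)`; non-singularity permits cancelling.
  rw [h0, h3, h2, h4, h5, mul_one, mul_one, mul_comm] at h1
  exact (mul_right_cancel₀ h6 h1).symm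

end IsPathSystem

end Solenoid

/-! ### The theorem, assembled from the path system. -/

theorem mainTheorem6 {X : Type*} [MeasurableSpace X]
    (r : X → X) (hr_meas : Measurable r) (hr_onto : Function.Surjective r)
    (hr_fin : ∀ x, (r ⁻¹' {x}).Finite)
    (μ : Measure X) [IsProbabilityMeasure μ] (hμ : Solenoid.StronglyInvariant r μ)
    (m₀ : X → ℂ) (h : X → ℝ) (hpair : Solenoid.IsPRFPair r μ m₀ h)
    (hm₀ : ∀ᵐ x ∂μ, m₀ x ≠ 0) :
    -- the measure on the projective limit, characterised by its marginals
    ∃ μhat : Measure (Solenoid.Sol r),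
      (∀ ν : Measure (Solenoid.Sol r), Solenoid.HasMarginals r μ m₀ h ν ↔ ν = μhat) ∧
    -- the unitary operator `U v = m₀ · (v ∘ r̂)`
    ∃ U : Lp ℂ 2 μhat ≃ₗᵢ[ℂ] Lp ℂ 2 μhat,
      (∀ v, U v =ᵐ[μhat] fun x => m₀ (Solenoid.θ r 0 x) * v (Solenoid.rhat r x)) ∧
    -- (1) the commutant
      ((∀ A : Lp ℂ 2 μhat →L[ℂ] Lp ℂ 2 μhat, Solenoid.Commutes r μhat U A →
          ∃ (f : Solenoid.Sol r → ℂ) (hf : Solenoid.IsCocycle r μhat f),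
            A = Solenoid.mulOp μhat hf.bdd) ∧
        (∀ (f : Solenoid.Sol r → ℂ) (hf : Solenoid.IsCocycle r μhat f),
          Solenoid.Commutes r μhat U (Solenoid.mulOp μhat hf.bdd))) ∧
    -- (2) the correspondence between harmonic functions and cocycles
      ((∀ h₀ : X → ℂ, Solenoid.IsDominatedHarmonic r μ m₀ h h₀ →
          ∃ f : Solenoid.Sol r → ℂ, Solenoid.IsCocycle r μhat f ∧
            (h₀ =ᵐ[μ] fun x => Solenoid.E₀ r μhat f x * h x) ∧
            ∀ f' : Solenoid.Sol r → ℂ, Solenoid.IsCocycle r μhat f' →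
              (h₀ =ᵐ[μ] fun x => Solenoid.E₀ r μhat f' x * h x) → f' =ᵐ[μhat] f) ∧
        (∀ f : Solenoid.Sol r → ℂ, Solenoid.IsCocycle r μhat f →
          Solenoid.IsDominatedHarmonic r μ m₀ h (fun x => Solenoid.E₀ r μhat f x * h x))) ∧
    -- (3) the cocycle as a limit
      (∀ (h₀ : X → ℂ) (f : Solenoid.Sol r → ℂ), Solenoid.IsDominatedHarmonic r μ m₀ h h₀ →
        Solenoid.IsCocycle r μhat f → (h₀ =ᵐ[μ] fun x => Solenoid.E₀ r μhat f x * h x) →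
          (∀ᵐ x ∂μhat, Tendsto
            (fun n : ℕ => h₀ (Solenoid.θ r n x) / (h (Solenoid.θ r n x) : ℂ)) atTop (𝓝 (f x))) ∧
          ∀ p : ℝ≥0∞, 1 ≤ p → p ≠ ∞ →
            (∀ n : ℕ, MemLp (fun x : Solenoid.Sol r =>
              h₀ (Solenoid.θ r n x) / (h (Solenoid.θ r n x) : ℂ)) p μhat) ∧
            Tendsto (fun n : ℕ => eLpNorm (fun x : Solenoid.Sol r =>
              h₀ (Solenoid.θ r n x) / (h (Solenoid.θ r n x) : ℂ) - f x) p μhat) atTop (𝓝 0)) := by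
  have H : Solenoid.IsFiniteCover r μ := ⟨hr_meas, hr_onto, hr_fin, hμ⟩
  obtain ⟨ν, hν⟩ := hpair.exists_measure H
  have S : Solenoid.IsPathSystem r μ m₀ h ν := ⟨H, hpair, hm₀, hν⟩
  have := S.isFiniteMeasure
  obtain ⟨U, hU⟩ := S.exists_unitary
  refine ⟨ν, fun ν' => ?_, U, hU,
    ⟨fun A hA => S.exists_eq_mulOp hU hA, fun f hf => S.commutes_mulOp hU hf⟩,
    ⟨fun h₀ hh => ?_, fun f hf => S.isDominatedHarmonic_E₀ hf⟩,
    fun h₀ f _ hf heq => ⟨S.tendsto_div hf heq, fun p hp hp' =>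
      ⟨S.memLp_div hf heq p, S.tendsto_eLpNorm_div hf heq hp hp'⟩⟩⟩
  · rw [hpair.hasMarginals_iff H]
    refine ⟨fun hν' => ?_, fun e => e ▸ hν⟩
    -- Only the constructed measure has to be known finite; the competitor is arbitrary.
    exact (Solenoid.measure_ext_of_map_θ hr_meas fun n => (hν n).trans (hν' n).symm).symm
  · obtain ⟨f, hf, heq⟩ := S.exists_cocycle hh
    exact ⟨f, hf, heq, fun f' hf' heq' => S.cocycle_unique hf heq hf' heq'⟩
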